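/- Let $\mathfrak g$ be a simple finite-dimensional complex Lie algebra with a nondegenerate symmetric invariant bilinear form $(\cdot|\cdot)$, let $\sigma$ be an automorphism of $\mathfrak g$ with $\sigma^N=I$ for an integer $N\ge 1$, and let $k\in\mathbb C$. Let $\hat{\mathfrak g}=\mathfrak g\otimes\mathbb C[t,t^{-1}]\oplus\mathbb C K$ be the affine Lie algebra with $K$ central and $$[a\otimes t^m,b\otimes t^n]=[a,b]\otimes t^{m+n}+m\,\delta_{m,-n}(a|b)K ,$$ and for an automorphism $\tau$ of $\mathfrak g$ with $\tau^N=I$ let $$\hat{\mathcal L}'(\mathfrak g,\tau)=\bigoplus_{j\in\mathbb Z}\{a\in\mathfrak g\mid \tau a=e^{2\pi i j/N}a\}\otimes t^j\;\oplus\;\mathbb C K\subset\hat{\mathfrak g}$$ be the twisted affine Lie algebra. Let $V_k(\mathfrak g)=\mathrm{Ind}_{\mathfrak g[t]\oplus\mathbb CK}^{\hat{\mathfrak g}}\mathbb C$ (where $\mathfrak g[t]$ acts on $\mathbb C$ by $0$ and $K$ by $k$) be the universal affine vertex algebra, in which $a\in\mathfrak g$ is identified with $(a\otimes t^{-1})\mathbf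 1$, and extend $\sigma$ to the automorphism of $V_k(\mathfrak g)$ with $\sigma\mathbf 1=\mathbf 1$ and $\sigma(a\otimes t^m)v=(\sigma a\otimes t^m)\sigma v$. Let $M$ be a $\sigma$-twisted $V_k(\mathfrak g)$-module, with fields $Y^M(a,z)=\sum_{m\in\frac1N\mathbb Z}a^M_{(m)}z^{-m-1}$, where $Y^M(\sigma a,z)=Y^M(a,e^{2\pi i}z)$. Then there is a unique Lie algebra homomorphism $\rho:\hat{\mathcal L}'(\mathfrak g,\sigma^{-1})\to\mathrm{End}(M)$ such that $$\rho(a\otimes t^j)=a^M_{(j/N)}\quad\text{whenever } j\in\mathbb Z,\ \sigma^{-1}a=e^{2\pi i j/N}a,\qquad \rho(K)=\tfrac kN\, I,$$ and its image is the Lie algebra generated by the modes $a^M_{(p/N)}$ $(a\in\mathfrak g,\ p\in\mathbb Z)$ of the fields $Y^M(a,z)$. Thus $M$ is a representation of $\hat{\mathcal L}'(\mathfrak g,\sigma^{-1})$ of level $k$, in the normalization where the level is the scalar by which $NK$ acts; in particular, for $m,n\in\frac1N\mathbb Z$ with $\sigma a=e^{-2\pi i m}a$ and $\sigma b=e^{-2\pi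 i n}b$, $$[a^M_{(m)},b^M_{(n)}]=[a,b]^M_{(m+n)}+m\,\delta_{m,-n}(a|b)k\,I .$$ -/

import Mathlib

open scoped TensorProduct

attribute [local instance 100] LieRing.ofAssociativeRing

noncomputable section

namespace AffineVertex

open VertexOperator (ncoeff)

/-! ## Calculus of fields

Fields on `V` are Mathlib's `VertexOperator ℂ V`; `ncoeff F n` is the mode `F_(n)`, the coefficient
of `z^(-n-1)`. -/

lemma finsum_eq_range {V : Type*} [AddCommGroup V] {f : ℕ → V} {L : ℕ} (h : ∀ i ≥ L, f i = 0) :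
    ∑ᶠ i, f i = ∑ i ∈ Finset.range L, f i := by
  apply finsum_eq_sum_of_support_subset
  intro i hi
  by_contra h'
  exact hi (h i (by simpa using h'))

lemma sum_square_eq_diag {V : Type*} [AddCommGroup V] (L : ℕ) (g : ℕ → ℕ → V) (h : ∀ i j, L ≤ i + j → g i j = 0) :
    ∑ i ∈ Finset.range L, ∑ j ∈ Finset.range L, g i j =
      ∑ s ∈ Finset.range L, ∑ p ∈ Finset.HasAntidiagonal.antidiagonal s, g p.1 p.2 := by
  simp_rw [Finset.Nat.sum_antidiagonal_eq_sum_range_succ g]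
  rw [Finset.sum_range_diag_flip]
  refine Finset.sum_congr rfl fun i hi => ?_
  symm
  apply Finset.sum_subset
  · intro j hj
    simp only [Finset.mem_range] at *
    omega
  · intro j _ hj
    simp only [Finset.mem_range] at *
    exact h i j (by omega)

section Fields

variable {V : Type*} [AddCommGroup V] [Module ℂ V]

/-- The vertex operator (field) `∑ₙ f n z^{-n-1}` with prescribed modes. -/
def ofModes (f : ℤ → Module.End ℂ V) (hf : ∀ v, ∃ L : ℤ, ∀ n ≥ L, f n v = 0) :
    VertexOperator ℂ V :=
  VertexOperator.of_coeff (fun n => f (-n - 1)) (by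
    intro v
    obtain ⟨L, hL⟩ := hf v
    refine ⟨-L, ?_⟩
    intro n hn
    by_contra h
    exact hn (hL _ (by omega)))

@[simp] lemma ncoeff_ofModes (f : ℤ → Module.End ℂ V) (hf) (n : ℤ) :
    ncoeff (ofModes f hf) n = f n := by
  rw [ofModes, VertexOperator.ncoeff_of_coeff]; congr 1; ring

lemma modes_ext {F G : VertexOperator ℂ V}
    (h : ∀ n v, ncoeff F n v = ncoeff G n v) : F = G := by
  apply HVertexOperator.coeff_inj
  funext n
  rw [VertexOperator.coeff_eq_ncoeff, VertexOperator.coeff_eq_ncoeff]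
  exact LinearMap.ext (h _)

lemma modes_trunc (F : VertexOperator ℂ V) (v : V) :
    ∃ L : ℤ, ∀ n ≥ L, ncoeff F n v = 0 := by
  refine ⟨-HahnSeries.order ((HahnModule.of ℂ).symm (F v)), fun n hn => ?_⟩
  exact VertexOperator.ncoeff_eq_zero_of_lt_order F n v (by omega)

lemma modes_trunc_nat (F : VertexOperator ℂ V) (n : ℤ) (v : V) :
    ∃ L : ℕ, ∀ i ≥ L, ncoeff F (n + (i : ℕ)) v = 0 := by
  obtain ⟨L, hL⟩ := modes_trunc F v
  exact ⟨(L - n).toNat, fun i hi => hL _ (by omega)⟩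

/-- A pointwise finite sum of operators. -/
def sumOp (f : ℕ → Module.End ℂ V) (hf : ∀ v, ∃ L : ℕ, ∀ i ≥ L, f i v = 0) : Module.End ℂ V where
  toFun v := ∑ᶠ i, f i v
  map_add' u v := by
    obtain ⟨L, hL⟩ := hf u
    obtain ⟨L', hL'⟩ := hf v
    rw [finsum_eq_range (L := max L L') (fun i hi => hL i (le_trans (le_max_left _ _) hi)),
      finsum_eq_range (L := max L L') (fun i hi => hL' i (le_trans (le_max_right _ _) hi)),
      finsum_eq_range (L := max L L') (fun i hi => ?_), ← Finset.sum_add_distrib]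
    · simp
    · simp [hL i (le_trans (le_max_left _ _) hi), hL' i (le_trans (le_max_right _ _) hi)]
  map_smul' c v := by
    obtain ⟨L, hL⟩ := hf v
    rw [finsum_eq_range hL, finsum_eq_range (L := L) (fun i hi => by simp [hL i hi])]
    simp [Finset.smul_sum]

/-- The first half of the `m`-th product of the fields `A` and `F`: its `n`-th mode is
`∑_{i ≥ 0} (-1)^i (m choose i) A_(m-i) F_(n+i)`. -/
def productLeft (m : ℤ) (A F : VertexOperator ℂ V) : VertexOperator ℂ V :=
  ofModes (fun n => sumOp (fun i : ℕ => ((-1 : ℤ) ^ i * Ring.choose m i) •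
      (ncoeff A (m - i) * ncoeff F (n + i)))
      (fun v => by
        obtain ⟨L, hL⟩ := modes_trunc_nat F n v
        exact ⟨L, fun i hi => by simp [hL i hi]⟩))
    (fun v => by
      obtain ⟨L, hL⟩ := modes_trunc F v
      refine ⟨L, fun n hn => ?_⟩
      change ∑ᶠ i, _ = (0 : V)
      rw [finsum_eq_range (L := 0)]
      · simp
      · intro i _
        simp [hL (n + i) (by omega)])

/-- The second half of the `m`-th product of the fields `A` and `F`: its `n`-th mode is
`∑_{i ≥ 0} (-1)^{m+i} (m choose i) F_(m+n-i) A_(i)`. -/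
def productRight (m : ℤ) (A F : VertexOperator ℂ V) : VertexOperator ℂ V :=
  ofModes (fun n => sumOp (fun i : ℕ => ((m.negOnePow : ℤ) * (-1 : ℤ) ^ i * Ring.choose m i) •
      (ncoeff F (m + n - i) * ncoeff A i))
      (fun v => by
        obtain ⟨L, hL⟩ := modes_trunc_nat A 0 v
        exact ⟨L, fun i hi => by simp [by simpa using hL i hi]⟩))
    (fun v => by
      obtain ⟨L, hL⟩ := modes_trunc_nat A 0 v
      have : ∀ i : ℕ, ∃ L' : ℤ, ∀ n ≥ L',
          ncoeff F n (ncoeff A i v) = 0 :=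
        fun i => modes_trunc F _
      choose B hB using this
      obtain ⟨C, hC⟩ := ((Finset.range L).image B).exists_le
      refine ⟨C + L - m, fun n hn => ?_⟩
      change ∑ᶠ i, _ = (0 : V)
      rw [finsum_eq_range (L := L) (fun i hi => by simp [by simpa using hL i hi])]
      apply Finset.sum_eq_zero
      intro i hi
      have h1 := hC _ (Finset.mem_image_of_mem B hi)
      have h2 := Finset.mem_range.1 hi
      simp [hB i (m + n - i) (by omega)])

/-- The `m`-th product `A_(m) F` of two fields on `V`, with modes
`(A_(m) F)_(n) = ∑_{i ≥ 0} (-1)^i (m choose i) (A_(m-i) F_(n+i) - (-1)^m F_(m+n-i) A_(i))`. -/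
def fieldProduct (m : ℤ) (A F : VertexOperator ℂ V) : VertexOperator ℂ V :=
  productLeft m A F - productRight m A F

lemma productLeft_mode (m : ℤ) (A F : VertexOperator ℂ V) (n : ℤ) (v : V) {L : ℕ}
    (hL : ∀ i ≥ L, ncoeff F (n + (i : ℕ)) v = 0) :
    ncoeff (productLeft m A F) n v = ∑ i ∈ Finset.range L,
      ((-1 : ℤ) ^ i * Ring.choose m i) •
        ncoeff A (m - i) (ncoeff F (n + i) v) := by
  rw [productLeft, ncoeff_ofModes]
  exact finsum_eq_range (fun i hi => by simp [hL i hi])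

lemma productRight_mode (m : ℤ) (A F : VertexOperator ℂ V) (n : ℤ) (v : V) {L : ℕ}
    (hL : ∀ i ≥ L, ncoeff A ((i : ℕ) : ℤ) v = 0) :
    ncoeff (productRight m A F) n v = ∑ i ∈ Finset.range L,
      ((m.negOnePow : ℤ) * (-1 : ℤ) ^ i * Ring.choose m i) •
        ncoeff F (m + n - i) (ncoeff A i v) := by
  rw [productRight, ncoeff_ofModes]
  exact finsum_eq_range (fun i hi => by simp [hL i hi])

lemma modes_trunc_all (F : VertexOperator ℂ V) (n : ℤ) (v : V) (B : VertexOperator ℂ V) :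
    ∃ L : ℕ, ∀ i j : ℕ, L ≤ i + j → ncoeff F (n + i) (ncoeff B j v) = 0 := by
  obtain ⟨L, hL⟩ := modes_trunc_nat B 0 v
  have : ∀ j : ℕ, ∃ L' : ℕ, ∀ i ≥ L',
      ncoeff F (n + (i : ℕ)) (ncoeff B j v) = 0 :=
    fun j => modes_trunc_nat F n _
  choose K hK using this
  obtain ⟨C, hC⟩ := ((Finset.range L).image K).exists_le
  refine ⟨C + L, fun i j hij => ?_⟩
  by_cases hj : j < L
  · have := hC _ (Finset.mem_image_of_mem K (Finset.mem_range.2 hj))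
    exact hK j i (by omega)
  · have := hL j (by omega)
    rw [zero_add] at this
    rw [this, map_zero]

lemma productLeft_lin (m : ℤ) (A F G : VertexOperator ℂ V) (c : ℂ) :
    productLeft m A (c • F + G) = c • productLeft m A F + productLeft m A G := by
  apply modes_ext
  intro n v
  obtain ⟨L, hL⟩ := modes_trunc_nat F n v
  obtain ⟨L', hL'⟩ := modes_trunc_nat G n v
  have h1 : ∀ i ≥ max L L', ncoeff F (n + (i : ℕ)) v = 0 :=
    fun i hi => hL i (le_trans (le_max_left _ _) hi)
  have h2 : ∀ i ≥ max L L', ncoeff G (n + (i : ℕ)) v = 0 :=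
    fun i hi => hL' i (le_trans (le_max_right _ _) hi)
  rw [map_add, map_smul, Pi.add_apply, LinearMap.add_apply, Pi.smul_apply, LinearMap.smul_apply,
    productLeft_mode m A F n v h1, productLeft_mode m A G n v h2,
    productLeft_mode m A (c • F + G) n v (L := max L L')
      (fun i hi => by simp [h1 i hi, h2 i hi]), Finset.smul_sum, ← Finset.sum_add_distrib]
  refine Finset.sum_congr rfl fun i _ => ?_
  simp [smul_comm c]

lemma productLeft_lin' (m : ℤ) (A B F : VertexOperator ℂ V) (c : ℂ) :
    productLeft m (c • A + B) F = c • productLeft m A F + productLeft m B F := by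
  apply modes_ext
  intro n v
  obtain ⟨L, hL⟩ := modes_trunc_nat F n v
  rw [map_add, map_smul, Pi.add_apply, LinearMap.add_apply, Pi.smul_apply, LinearMap.smul_apply,
    productLeft_mode m A F n v hL, productLeft_mode m B F n v hL,
    productLeft_mode m _ F n v hL, Finset.smul_sum, ← Finset.sum_add_distrib]
  refine Finset.sum_congr rfl fun i _ => ?_
  simp [smul_comm c]

lemma productRight_lin (m : ℤ) (A F G : VertexOperator ℂ V) (c : ℂ) :
    productRight m A (c • F + G) = c • productRight m A F + productRight m A G := by
  apply modes_ext
  intro n v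
  obtain ⟨L, hL⟩ := modes_trunc_nat A 0 v
  simp only [zero_add] at hL
  rw [map_add, map_smul, Pi.add_apply, LinearMap.add_apply, Pi.smul_apply, LinearMap.smul_apply,
    productRight_mode m A F n v hL, productRight_mode m A G n v hL,
    productRight_mode m A _ n v hL, Finset.smul_sum, ← Finset.sum_add_distrib]
  refine Finset.sum_congr rfl fun i _ => ?_
  simp [smul_comm c]

lemma productRight_lin' (m : ℤ) (A B F : VertexOperator ℂ V) (c : ℂ) :
    productRight m (c • A + B) F = c • productRight m A F + productRight m B F := by
  apply modes_ext
  intro n v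
  obtain ⟨L, hL⟩ := modes_trunc_nat A 0 v
  obtain ⟨L', hL'⟩ := modes_trunc_nat B 0 v
  simp only [zero_add] at hL hL'
  have h1 : ∀ i ≥ max L L', ncoeff A ((i : ℕ) : ℤ) v = 0 :=
    fun i hi => hL i (le_trans (le_max_left _ _) hi)
  have h2 : ∀ i ≥ max L L', ncoeff B ((i : ℕ) : ℤ) v = 0 :=
    fun i hi => hL' i (le_trans (le_max_right _ _) hi)
  rw [map_add, map_smul, Pi.add_apply, LinearMap.add_apply, Pi.smul_apply, LinearMap.smul_apply,
    productRight_mode m A F n v h1, productRight_mode m B F n v h2,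
    productRight_mode m _ F n v (L := max L L')
      (fun i hi => by simp [h1 i hi, h2 i hi]), Finset.smul_sum, ← Finset.sum_add_distrib]
  refine Finset.sum_congr rfl fun i _ => ?_
  simp [smul_comm c]

lemma fieldProduct_lin (m : ℤ) (A F G : VertexOperator ℂ V) (c : ℂ) :
    fieldProduct m A (c • F + G) = c • fieldProduct m A F + fieldProduct m A G := by
  rw [fieldProduct, productLeft_lin, productRight_lin, fieldProduct, fieldProduct, smul_sub]
  abel

lemma fieldProduct_lin' (m : ℤ) (A B F : VertexOperator ℂ V) (c : ℂ) :
    fieldProduct m (c • A + B) F = c • fieldProduct m A F + fieldProduct m B F := by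
  rw [fieldProduct, productLeft_lin', productRight_lin', fieldProduct, fieldProduct, smul_sub]
  abel

lemma productLeft_comm_right (m l : ℤ) (A B F : VertexOperator ℂ V) :
    productLeft m A (productRight l B F) = productRight l B (productLeft m A F) := by
  apply modes_ext
  intro n v
  obtain ⟨L, hL⟩ := modes_trunc_nat B 0 v
  simp only [zero_add] at hL
  obtain ⟨I1, hI1⟩ := modes_trunc_nat (productRight l B F) n v
  have : ∀ j : ℕ, ∃ L' : ℕ, ∀ i ≥ L',
      ncoeff F (l + n - j + (i : ℕ)) (ncoeff B j v) = 0 :=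
    fun j => modes_trunc_nat F _ _
  choose K hK using this
  obtain ⟨C, hC⟩ := ((Finset.range L).image K).exists_le
  rw [productLeft_mode m A _ n v (L := max I1 C)
    (fun i hi => hI1 i (le_trans (le_max_left _ _) hi)), productRight_mode l B _ n v hL]
  simp_rw [productRight_mode l B F _ v hL]
  simp_rw [map_sum, Finset.smul_sum]
  rw [Finset.sum_comm]
  refine Finset.sum_congr rfl fun j hj => ?_
  rw [productLeft_mode m A F _ _ (L := max I1 C) (fun i hi => hK j i
    (le_trans (hC _ (Finset.mem_image_of_mem K hj)) (le_trans (le_max_right _ _) hi))),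
    Finset.smul_sum]
  refine Finset.sum_congr rfl fun i _ => ?_
  rw [map_zsmul, smul_smul, smul_smul, mul_comm]
  congr 4
  ring_nf

lemma choose_absorb (m : ℤ) (i : ℕ) :
    (m - i) * Ring.choose m i = m * Ring.choose (m - 1) i := by
  have h1 := Ring.choose_smul_choose m (n := i + 1) (k := 1) (by omega)
  have h2 := Ring.choose_smul_choose m (n := i + 1) (k := i) (by omega)
  simp at h1 h2
  linarith

lemma productLeft_productLeft_mode (m l : ℤ) (A B F : VertexOperator ℂ V) (n : ℤ) (v : V) {L : ℕ}
    (hL : ∀ i ≥ L, ncoeff F (n + (i : ℕ)) v = 0) :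
    ncoeff (productLeft m A (productLeft l B F)) n v =
      ∑ s ∈ Finset.range L, ∑ p ∈ Finset.HasAntidiagonal.antidiagonal s,
        ((-1 : ℤ) ^ s * (Ring.choose m p.1 * Ring.choose l p.2)) •
          ncoeff A (m - p.1) (ncoeff B (l - p.2)
            (ncoeff F (n + s) v)) := by
  have key : ∀ i : ℕ, ncoeff (productLeft l B F) (n + i) v =
      ∑ j ∈ Finset.range L, ((-1 : ℤ) ^ j * Ring.choose l j) •
        ncoeff B (l - j) (ncoeff F (n + i + j) v) := fun i =>
    productLeft_mode l B F (n + i) v (fun j hj => by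
      have := hL (i + j) (by omega)
      rwa [Nat.cast_add, ← add_assoc] at this)
  rw [productLeft_mode m A _ n v (L := L) (fun i hi => by
    rw [key]
    refine Finset.sum_eq_zero fun j _ => ?_
    have := hL (i + j) (by omega)
    rw [Nat.cast_add, ← add_assoc] at this
    rw [this, map_zero, smul_zero])]
  simp_rw [key, map_sum, Finset.smul_sum]
  rw [sum_square_eq_diag L (fun i j => ((-1 : ℤ) ^ i * Ring.choose m i) •
      ncoeff A (m - i) (((-1 : ℤ) ^ j * Ring.choose l j) •
        ncoeff B (l - j) (ncoeff F (n + i + j) v)))]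
  · refine Finset.sum_congr rfl fun s _ => Finset.sum_congr rfl fun p hp => ?_
    rw [Finset.HasAntidiagonal.mem_antidiagonal] at hp
    subst hp
    rw [map_zsmul, smul_smul]
    congr 1
    · ring
    · push_cast
      rw [add_assoc]
  · intro i j hij
    have := hL (i + j) (by omega)
    rw [Nat.cast_add, ← add_assoc] at this
    simp [this]

lemma productRight_productRight_mode (m l : ℤ) (A B F : VertexOperator ℂ V) (n : ℤ) (v : V) {L : ℕ}
    (hA : ∀ i ≥ L, ncoeff A ((i : ℕ) : ℤ) v = 0)
    (hL : ∀ i j : ℕ, L ≤ i + j →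
      ncoeff B j (ncoeff A i v) = 0) :
    ncoeff (productRight m A (productRight l B F)) n v =
      ∑ s ∈ Finset.range L, ∑ p ∈ Finset.HasAntidiagonal.antidiagonal s,
        (((m + l).negOnePow : ℤ) * (-1 : ℤ) ^ s * (Ring.choose m p.1 * Ring.choose l p.2)) •
          ncoeff F (m + l + n - s) (ncoeff B p.2
            (ncoeff A p.1 v)) := by
  rw [productRight_mode m A _ n v hA]
  simp_rw [fun i : ℕ => productRight_mode l B F (m + n - i) (ncoeff A i v)
    (L := L) (fun j hj => hL i j (by omega)), Finset.smul_sum]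
  rw [sum_square_eq_diag L]
  · refine Finset.sum_congr rfl fun s _ => Finset.sum_congr rfl fun p hp => ?_
    rw [Finset.HasAntidiagonal.mem_antidiagonal] at hp
    subst hp
    rw [smul_smul]
    congr 1
    · rw [Int.negOnePow_add]
      push_cast
      ring
    · congr 2
      push_cast
      ring_nf
  · intro i j hij
    simp [hL i j hij]

/-- Commutator of two left multiplications by fields whose modes close on a third field and a
central term. -/
lemma productLeft_commutator (A B C : VertexOperator ℂ V) (c : ℂ)
    (h : ∀ x y : ℤ, ∀ v, ncoeff A x (ncoeff B y v) -
      ncoeff B y (ncoeff A x v) =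
      ncoeff C (x + y) v + (if x + y = 0 then (x : ℂ) * c else 0) • v)
    (m l : ℤ) (F : VertexOperator ℂ V) :
    productLeft m A (productLeft l B F) - productLeft l B (productLeft m A F) =
      productLeft (m + l) C F + (if m + l = 0 then (m : ℂ) * c else 0) • F := by
  apply modes_ext
  intro n v
  obtain ⟨L, hL⟩ := modes_trunc_nat F n v
  replace hL : ∀ i ≥ L + 1, ncoeff F (n + (i : ℕ)) v = 0 :=
    fun i hi => hL i (by omega)
  simp only [map_add, map_sub, map_smul, Pi.add_apply, Pi.sub_apply, LinearMap.add_apply,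
    Pi.smul_apply, LinearMap.smul_apply, LinearMap.sub_apply]
  rw [productLeft_productLeft_mode m l A B F n v hL,
    productLeft_productLeft_mode l m B A F n v hL, productLeft_mode _ C F n v hL]
  have hsw : ∀ s : ℕ, ∑ p ∈ Finset.HasAntidiagonal.antidiagonal s,
        ((-1 : ℤ) ^ s * (Ring.choose l p.1 * Ring.choose m p.2)) •
          ncoeff B (l - p.1) (ncoeff A (m - p.2)
            (ncoeff F (n + s) v)) = ∑ p ∈ Finset.HasAntidiagonal.antidiagonal s,
        ((-1 : ℤ) ^ s * (Ring.choose m p.1 * Ring.choose l p.2)) •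
          ncoeff B (l - p.2) (ncoeff A (m - p.1)
            (ncoeff F (n + s) v)) := by
    intro s
    rw [← Finset.Nat.sum_antidiagonal_swap]
    refine Finset.sum_congr rfl fun p _ => ?_
    simp only [Prod.fst_swap, Prod.snd_swap]
    rw [mul_comm (Ring.choose l p.2)]
  simp_rw [hsw]
  rw [← Finset.sum_sub_distrib]
  have hs : ∀ s ∈ Finset.range (L + 1), (∑ p ∈ Finset.HasAntidiagonal.antidiagonal s,
        ((-1 : ℤ) ^ s * (Ring.choose m p.1 * Ring.choose l p.2)) •
          ncoeff A (m - p.1) (ncoeff B (l - p.2)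
            (ncoeff F (n + s) v)) - ∑ p ∈ Finset.HasAntidiagonal.antidiagonal s,
        ((-1 : ℤ) ^ s * (Ring.choose m p.1 * Ring.choose l p.2)) •
          ncoeff B (l - p.2) (ncoeff A (m - p.1)
            (ncoeff F (n + s) v))) =
      ((-1 : ℤ) ^ s * Ring.choose (m + l) s) • ncoeff C (m + l - s)
          (ncoeff F (n + s) v) +
        (if s = 0 then (if m + l = 0 then (m : ℂ) * c else 0) • ncoeff F n v
          else 0) := by
    intro s _
    rw [← Finset.sum_sub_distrib]
    simp_rw [← smul_sub, h]
    have e1 : ∀ p ∈ Finset.HasAntidiagonal.antidiagonal s,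
        ((-1 : ℤ) ^ s * (Ring.choose m p.1 * Ring.choose l p.2)) •
          (ncoeff C (m - p.1 + (l - p.2)) (ncoeff F (n + s) v) +
            (if m - p.1 + (l - p.2) = 0 then ((m - p.1 : ℤ) : ℂ) * c else 0) •
              ncoeff F (n + s) v) =
        (Ring.choose m p.1 * Ring.choose l p.2) • ((-1 : ℤ) ^ s •
          ncoeff C (m + l - s) (ncoeff F (n + s) v)) +
        (Ring.choose (m - 1) p.1 * Ring.choose l p.2) • ((-1 : ℤ) ^ s •
          ((if m + l = s then (m : ℂ) * c else 0) • ncoeff F (n + s) v)) := by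
      intro p hp
      rw [Finset.HasAntidiagonal.mem_antidiagonal] at hp
      have e : m - p.1 + (l - p.2) = m + l - s := by
        rw [← hp]; push_cast; ring
      rw [e, smul_add]
      congr 1
      · rw [smul_smul, mul_comm]
      · by_cases hm : m + l = s
        · rw [if_pos (by omega), if_pos hm]
          have := choose_absorb m p.1
          rw [← Int.cast_smul_eq_zsmul ℂ, ← Int.cast_smul_eq_zsmul ℂ, ← Int.cast_smul_eq_zsmul ℂ,
            smul_smul, smul_smul, smul_smul]
          congr 1
          have h' : ((m - p.1 : ℤ) : ℂ) * (Ring.choose m p.1 : ℤ) =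
            (m : ℂ) * (Ring.choose (m - 1) p.1 : ℤ) := by exact_mod_cast this
          push_cast at h' ⊢
          linear_combination (-1 : ℂ) ^ s * (Ring.choose l p.2 : ℤ) * c * h'
        · rw [if_neg (by omega), if_neg hm]
          simp
    rw [Finset.sum_congr rfl e1, Finset.sum_add_distrib, ← Finset.sum_smul, ← Finset.sum_smul,
      ← Ring.add_choose_eq s (Commute.all m l), ← Ring.add_choose_eq s (Commute.all (m - 1) l)]
    congr 1
    · rw [smul_smul, mul_comm]
    · rcases Nat.eq_zero_or_pos s with rfl | hs
      · simp
      · rw [if_neg (show ¬ s = 0 by omega)]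
        by_cases hm : m + l = s
        · have : m - 1 + l = ((s - 1 : ℕ) : ℤ) := by omega
          rw [this, Ring.choose_natCast, Nat.choose_eq_zero_of_lt (by omega)]
          simp
        · simp [hm]
  rw [Finset.sum_congr rfl hs, Finset.sum_add_distrib]
  simp

/-- Commutator of two right multiplications. -/
lemma productRight_commutator (A B C : VertexOperator ℂ V) (c : ℂ)
    (h : ∀ x y : ℤ, ∀ v, ncoeff A x (ncoeff B y v) -
      ncoeff B y (ncoeff A x v) =
      ncoeff C (x + y) v + (if x + y = 0 then (x : ℂ) * c else 0) • v)
    (m l : ℤ) (F : VertexOperator ℂ V) :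
    productRight m A (productRight l B F) - productRight l B (productRight m A F) =
      - productRight (m + l) C F := by
  apply modes_ext
  intro n v
  obtain ⟨L1, h1⟩ := modes_trunc_all A 0 v B
  obtain ⟨L2, h2⟩ := modes_trunc_all B 0 v A
  obtain ⟨L3, h3⟩ := modes_trunc_nat A 0 v
  obtain ⟨L4, h4⟩ := modes_trunc_nat B 0 v
  obtain ⟨L5, h5⟩ := modes_trunc_nat C 0 v
  simp only [zero_add] at h1 h2 h3 h4 h5
  set L := L1 + L2 + L3 + L4 + L5
  simp only [map_sub, map_neg, Pi.sub_apply, LinearMap.sub_apply, Pi.neg_apply,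
    LinearMap.neg_apply]
  rw [productRight_productRight_mode m l A B F n v (L := L) (fun i hi => h3 i (by omega))
      (fun i j hij => h2 j i (by omega)),
    productRight_productRight_mode l m B A F n v (L := L) (fun i hi => h4 i (by omega))
      (fun i j hij => h1 j i (by omega)),
    productRight_mode _ C F n v (L := L) (fun i hi => h5 i (by omega)), ← Finset.sum_sub_distrib,
    ← Finset.sum_neg_distrib]
  refine Finset.sum_congr rfl fun s _ => ?_
  rw [← Finset.Nat.sum_antidiagonal_swap (n := s) (f := fun p : ℕ × ℕ =>
    (((l + m).negOnePow : ℤ) * (-1 : ℤ) ^ s * (Ring.choose l p.1 * Ring.choose m p.2)) •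
          ncoeff F (l + m + n - s) (ncoeff A p.2
            (ncoeff B p.1 v))), ← Finset.sum_sub_distrib,
    Ring.add_choose_eq s (Commute.all m l), Finset.mul_sum, Finset.sum_smul,
    ← Finset.sum_neg_distrib]
  refine Finset.sum_congr rfl fun p hp => ?_
  rw [Finset.HasAntidiagonal.mem_antidiagonal] at hp
  simp only [Prod.fst_swap, Prod.snd_swap]
  rw [add_comm l m, mul_comm (Ring.choose l p.2), ← smul_sub, ← map_sub, ← smul_neg, ← map_neg]
  congr 2
  rw [← neg_sub, h, ← hp]
  have : (if (p.1 : ℤ) + p.2 = 0 then ((p.1 : ℤ) : ℂ) * c else 0) = 0 := by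
    split_ifs with h0
    · have : p.1 = 0 := by omega
      simp [this]
    · rfl
  rw [this, zero_smul, add_zero]
  push_cast
  rfl

lemma fieldProduct_commutator (A B C : VertexOperator ℂ V) (c : ℂ)
    (h : ∀ x y : ℤ, ∀ v, ncoeff A x (ncoeff B y v) -
      ncoeff B y (ncoeff A x v) =
      ncoeff C (x + y) v + (if x + y = 0 then (x : ℂ) * c else 0) • v)
    (m l : ℤ) (F : VertexOperator ℂ V) :
    fieldProduct m A (fieldProduct l B F) - fieldProduct l B (fieldProduct m A F) =
      fieldProduct (m + l) C F + (if m + l = 0 then (m : ℂ) * c else 0) • F := by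
  have hneg : ∀ G : VertexOperator ℂ V, (-1 : ℂ) • G = -G := fun G => neg_one_smul ℂ G
  have hl : ∀ (m : ℤ) (A F G : VertexOperator ℂ V),
      productLeft m A (F - G) = productLeft m A F - productLeft m A G := by
    intro m A F G
    have := productLeft_lin m A G F (-1)
    rwa [hneg, hneg, ← sub_eq_neg_add, ← sub_eq_neg_add] at this
  have hr : ∀ (m : ℤ) (A F G : VertexOperator ℂ V),
      productRight m A (F - G) = productRight m A F - productRight m A G := by
    intro m A F G
    have := productRight_lin m A G F (-1)
    rwa [hneg, hneg, ← sub_eq_neg_add, ← sub_eq_neg_add] at this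
  simp only [fieldProduct, hl, hr]
  rw [← productLeft_comm_right, ← productLeft_comm_right]
  have e1 := productLeft_commutator A B C c h m l F
  have e2 := productRight_commutator A B C c h m l F
  rw [sub_eq_iff_eq_add] at e1 e2
  rw [e1, e2]
  abel

/-- Multiplication of a field by `z^m`. -/
def shiftField (m : ℤ) (F : VertexOperator ℂ V) : VertexOperator ℂ V :=
  ofModes (fun n => ncoeff F (n + m)) (fun v => by
    obtain ⟨L, hL⟩ := modes_trunc F v
    exact ⟨L - m, fun n hn => hL _ (by omega)⟩)

@[simp] lemma ncoeff_shiftField (m : ℤ) (F : VertexOperator ℂ V) (n : ℤ) :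
    ncoeff (shiftField m F) n = ncoeff F (n + m) := ncoeff_ofModes _ _ _

lemma shiftField_zero (F : VertexOperator ℂ V) : shiftField 0 F = F := by
  apply modes_ext; simp

lemma shiftField_shiftField (m l : ℤ) (F : VertexOperator ℂ V) :
    shiftField m (shiftField l F) = shiftField (l + m) F := by
  apply modes_ext; intro n v; simp; congr 2; ring_nf

lemma productLeft_succ (k : ℤ) (A F : VertexOperator ℂ V) :
    productLeft (k + 1) A F =
      productLeft k (shiftField 1 A) F - shiftField 1 (productLeft k A F) := by
  apply modes_ext
  intro n v
  obtain ⟨L, hL⟩ := modes_trunc_nat F n v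
  have hL' : ∀ i ≥ L + 1, ncoeff F (n + (i : ℕ)) v = 0 := fun i hi => hL i (by omega)
  rw [map_sub, Pi.sub_apply, LinearMap.sub_apply, ncoeff_shiftField,
    productLeft_mode _ _ _ n v hL', productLeft_mode _ _ _ n v hL',
    productLeft_mode _ _ _ (n + 1) v (L := L) (fun i hi => by
      have := hL (i + 1) (by omega)
      rwa [Nat.cast_add, Nat.cast_one, add_comm (i : ℤ), ← add_assoc] at this),
    Finset.sum_range_succ', Finset.sum_range_succ' _ L,
    show ∀ a b c : V, a + b - c = a - c + b from fun a b c => by abel,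
    ← Finset.sum_sub_distrib]
  congr 1
  · refine Finset.sum_congr rfl fun i _ => ?_
    rw [Ring.choose_succ_succ, ncoeff_shiftField]
    have e1 : k - ((i + 1 : ℕ) : ℤ) + 1 = k - i := by push_cast; ring
    have e2 : k + 1 - ((i + 1 : ℕ) : ℤ) = k - i := by push_cast; ring
    have e3 : n + 1 + (i : ℤ) = n + ((i + 1 : ℕ) : ℤ) := by push_cast; ring
    rw [e1, e2, e3, ← sub_smul]
    congr 1
    ring
  · simp

lemma productRight_succ (k : ℤ) (A F : VertexOperator ℂ V) :
    productRight (k + 1) A F =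
      productRight k (shiftField 1 A) F - shiftField 1 (productRight k A F) := by
  apply modes_ext
  intro n v
  obtain ⟨L, hL⟩ := modes_trunc_nat A 0 v
  simp only [zero_add] at hL
  have hL' : ∀ i ≥ L + 1, ncoeff A ((i : ℕ) : ℤ) v = 0 := fun i hi => hL i (by omega)
  rw [map_sub, Pi.sub_apply, LinearMap.sub_apply, ncoeff_shiftField,
    productRight_mode _ _ _ n v hL', productRight_mode _ _ _ (n + 1) v hL',
    productRight_mode _ (shiftField 1 A) _ n v (L := L) (fun i hi => by
      have := hL (i + 1) (by omega)
      rw [ncoeff_shiftField]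
      rwa [Nat.cast_add, Nat.cast_one] at this),
    Finset.sum_range_succ', Finset.sum_range_succ' _ L, ← sub_sub, ← Finset.sum_sub_distrib,
    sub_eq_add_neg _ (_ • _)]
  congr 1
  · refine Finset.sum_congr rfl fun i _ => ?_
    rw [Ring.choose_succ_succ, ncoeff_shiftField]
    have e1 : k + (n + 1) - ((i + 1 : ℕ) : ℤ) = k + n - i := by push_cast; ring
    have e2 : k + 1 + n - ((i + 1 : ℕ) : ℤ) = k + n - i := by push_cast; ring
    have e3 : (i : ℤ) + 1 = ((i + 1 : ℕ) : ℤ) := by push_cast; ring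
    rw [e1, e2, e3, ← sub_smul, Int.negOnePow_succ]
    congr 1
    push_cast
    ring
  · rw [Int.negOnePow_succ]
    simp [add_assoc, add_comm (1 : ℤ) n]

lemma shiftField_sub (m : ℤ) (F G : VertexOperator ℂ V) :
    shiftField m (F - G) = shiftField m F - shiftField m G := by
  apply modes_ext; intro n v; simp

lemma fieldProduct_succ (k : ℤ) (A F : VertexOperator ℂ V) :
    fieldProduct (k + 1) A F =
      fieldProduct k (shiftField 1 A) F - shiftField 1 (fieldProduct k A F) := by
  simp only [fieldProduct, productLeft_succ, productRight_succ, shiftField_sub]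
  abel

lemma fieldProduct_zero_mode (A F : VertexOperator ℂ V) (n : ℤ) (v : V) :
    ncoeff (fieldProduct 0 A F) n v = ncoeff A 0 (ncoeff F n v) - ncoeff F n (ncoeff A 0 v) := by
  obtain ⟨L1, h1⟩ := modes_trunc_nat F n v
  obtain ⟨L2, h2⟩ := modes_trunc_nat A 0 v
  simp only [zero_add] at h2
  rw [fieldProduct, map_sub, Pi.sub_apply, LinearMap.sub_apply,
    productLeft_mode 0 A F n v (L := L1 + 1) (fun i hi => h1 i (by omega)),
    productRight_mode 0 A F n v (L := L2 + 1) (fun i hi => h2 i (by omega)),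
    Finset.sum_range_succ', Finset.sum_range_succ']
  simp

/-- The difference operator `(c x y) ↦ c (x + 1) y - c x (y + 1)`. -/
def diffOp {E : Type*} [AddCommGroup E] (c : ℤ → ℤ → E) : ℤ → ℤ → E :=
  fun x y => c (x + 1) y - c x (y + 1)

/-- The commutators of the modes of two fields. -/
def modeComm (A F : VertexOperator ℂ V) (x y : ℤ) : Module.End ℂ V :=
  ncoeff A x * ncoeff F y - ncoeff F y * ncoeff A x

lemma fieldProduct_nat_mode (N : ℕ) (A F : VertexOperator ℂ V) (m n : ℤ) :
    ncoeff (fieldProduct N (shiftField m A) F) n = diffOp^[N] (modeComm A F) m n := by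
  induction N generalizing m n with
  | zero =>
    ext v
    simp [fieldProduct_zero_mode, modeComm]
  | succ N ih =>
    rw [Function.iterate_succ_apply', diffOp, ← ih, ← ih, Nat.cast_succ, fieldProduct_succ,
      shiftField_shiftField, map_sub, Pi.sub_apply, ncoeff_shiftField]

/-- Two fields are local if `(z - w)^N [A(z), F(w)] = 0` for some `N`. -/
def IsLocal (A F : VertexOperator ℂ V) : Prop := ∃ N : ℕ, diffOp^[N] (modeComm A F) = 0

lemma diffOp_zero {E : Type*} [AddCommGroup E] (N : ℕ) :
    diffOp^[N] (0 : ℤ → ℤ → E) = 0 := by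
  induction N with
  | zero => rfl
  | succ N ih => rw [Function.iterate_succ_apply', ih]; funext x y; simp [diffOp]

lemma diffOp_ge {E : Type*} [AddCommGroup E] {c : ℤ → ℤ → E} {N M : ℕ} (h : diffOp^[N] c = 0)
    (hM : N ≤ M) : diffOp^[M] c = 0 := by
  obtain ⟨d, rfl⟩ := Nat.exists_eq_add_of_le hM
  rw [add_comm, Function.iterate_add_apply, h, diffOp_zero]

lemma diffOp_add {E : Type*} [AddCommGroup E] (c d : ℤ → ℤ → E) (N : ℕ) :
    diffOp^[N] (c + d) = diffOp^[N] c + diffOp^[N] d := by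
  induction N generalizing c d with
  | zero => rfl
  | succ N ih =>
    rw [Function.iterate_succ_apply, Function.iterate_succ_apply, Function.iterate_succ_apply, ← ih]
    congr 1
    funext x y
    simp only [diffOp, Pi.add_apply]
    abel

lemma diffOp_map {E E' : Type*} [AddCommGroup E] [AddCommGroup E'] (f : E →+ E')
    (c : ℤ → ℤ → E) (N : ℕ) :
    diffOp^[N] (fun x y => f (c x y)) = fun x y => f (diffOp^[N] c x y) := by
  induction N generalizing c with
  | zero => rfl
  | succ N ih =>
    rw [Function.iterate_succ_apply, Function.iterate_succ_apply, ← ih]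
    congr 1
    funext x y
    simp [diffOp]

lemma diffOp_swap {E : Type*} [AddCommGroup E] (c : ℤ → ℤ → E) (N : ℕ) :
    diffOp^[N] (fun x y => c y x) = fun x y => (-1 : ℤ) ^ N • diffOp^[N] c y x := by
  induction N with
  | zero => simp
  | succ N ih =>
    rw [Function.iterate_succ_apply', Function.iterate_succ_apply', ih]
    funext x y
    simp only [diffOp, pow_succ]
    rw [← smul_sub, mul_smul, neg_one_smul, neg_sub]

lemma IsLocal.symm {A F : VertexOperator ℂ V} (h : IsLocal A F) : IsLocal F A := by
  obtain ⟨N, hN⟩ := h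
  refine ⟨N, ?_⟩
  have e : modeComm F A = fun x y => (-AddMonoidHom.id (Module.End ℂ V))
      ((fun x y => modeComm A F y x) x y) := by
    funext x y
    simp [modeComm]
  rw [e, diffOp_map, diffOp_swap, hN]
  funext x y
  simp

lemma IsLocal.add {A F G : VertexOperator ℂ V} (h : IsLocal F A) (h' : IsLocal G A) :
    IsLocal (F + G) A := by
  obtain ⟨N, hN⟩ := h
  obtain ⟨M, hM⟩ := h'
  refine ⟨max N M, ?_⟩
  have e : modeComm (F + G) A = modeComm F A + modeComm G A := by
    funext x y
    simp only [modeComm, map_add, Pi.add_apply, add_mul, mul_add]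
    abel
  rw [e, diffOp_add, diffOp_ge hN (le_max_left _ _), diffOp_ge hM (le_max_right _ _), add_zero]

lemma IsLocal.smul {A F : VertexOperator ℂ V} (c : ℂ) (h : IsLocal F A) : IsLocal (c • F) A := by
  obtain ⟨N, hN⟩ := h
  refine ⟨N, ?_⟩
  have e : modeComm (c • F) A = fun x y =>
      (DistribSMul.toAddMonoidHom (Module.End ℂ V) c) (modeComm F A x y) := by
    funext x y
    simp [modeComm, smul_sub]
  rw [e, diffOp_map, hN]
  funext x y
  simp

lemma fieldProduct_mode (m : ℤ) (A F : VertexOperator ℂ V) (n : ℤ) (v : V) {L : ℕ}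
    (hF : ∀ i ≥ L, ncoeff F (n + (i : ℕ)) v = 0) (hA : ∀ i ≥ L, ncoeff A ((i : ℕ) : ℤ) v = 0) :
    ncoeff (fieldProduct m A F) n v =
      ∑ i ∈ Finset.range L, ((-1 : ℤ) ^ i * Ring.choose m i) • ncoeff A (m - i) (ncoeff F (n + i) v)
      - ∑ i ∈ Finset.range L, ((m.negOnePow : ℤ) * (-1 : ℤ) ^ i * Ring.choose m i) •
        ncoeff F (m + n - i) (ncoeff A i v) := by
  rw [fieldProduct, map_sub, Pi.sub_apply, LinearMap.sub_apply, productLeft_mode m A F n v hF,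
    productRight_mode m A F n v hA]

section Dong

variable (E : Type*) [Ring E]

/-- The difference operator in the first two variables. -/
def diffXY : Module.End ℤ (ℤ → ℤ → ℤ → E) where
  toFun f x y z := f (x + 1) y z - f x (y + 1) z
  map_add' f g := by funext x y z; simp only [Pi.add_apply]; abel
  map_smul' c f := by funext x y z; simp [smul_sub]

/-- The difference operator in the first and last variables. -/
def diffXZ : Module.End ℤ (ℤ → ℤ → ℤ → E) where
  toFun f x y z := f (x + 1) y z - f x y (z + 1)
  map_add' f g := by funext x y z; simp only [Pi.add_apply]; abel
  map_smul' c f := by funext x y z; simp [smul_sub]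

/-- The difference operator in the last two variables. -/
def diffYZ : Module.End ℤ (ℤ → ℤ → ℤ → E) where
  toFun f x y z := f x (y + 1) z - f x y (z + 1)
  map_add' f g := by funext x y z; simp only [Pi.add_apply]; abel
  map_smul' c f := by funext x y z; simp [smul_sub]

variable {E}

lemma diffYZ_eq : diffYZ E = diffXZ E - diffXY E := by
  refine LinearMap.ext fun f => ?_
  funext x y z
  simp [diffYZ, diffXZ, diffXY]

lemma diffXY_comm_diffXZ :
    Commute (diffXY E) (diffXZ E) := by
  refine LinearMap.ext fun f => ?_
  funext x y z
  simp only [Module.End.mul_apply, diffXZ, diffXY, LinearMap.coe_mk, AddHom.coe_mk]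
  abel

lemma dong_algebra {R M : Type*} [Ring R] [AddCommGroup M] [Module R M] {a b : R}
    (hab : Commute a b) {n s : ℕ} {t : M} (ha : a ^ s • t = 0)
    (hb : (b ^ n * (b - a) ^ n) • t = 0) : (b - a) ^ (s + n + n) • t = 0 := by
  have hba : Commute b (-a) := hab.symm.neg_right
  have hd : Commute (b - a) a := (hab.symm).sub_left (Commute.refl a)
  have hdb : Commute (b - a) b := (Commute.refl b).sub_left hab
  rw [pow_add, sub_eq_add_neg b a, hba.add_pow', Finset.sum_mul, Finset.sum_smul]
  refine Finset.sum_eq_zero fun p hp => ?_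
  rw [Finset.HasAntidiagonal.mem_antidiagonal] at hp
  rw [← sub_eq_add_neg, smul_mul_assoc, smul_assoc]
  convert smul_zero _ using 2
  by_cases h : s ≤ p.2
  · obtain ⟨d, hd'⟩ := Nat.exists_eq_add_of_le h
    have e : b ^ p.1 * (-a) ^ p.2 * (b - a) ^ n =
        (b ^ p.1 * ((b - a) ^ n * ((-1) ^ p.2 * a ^ d))) * a ^ s := by
      have h1 : Commute ((-a) ^ p.2) ((b - a) ^ n) := (hd.neg_right.symm).pow_pow _ _
      rw [mul_assoc, h1.eq, neg_pow a, hd', pow_add a, (Commute.refl a).pow_pow s d]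
      simp only [mul_assoc]
    rw [e, mul_smul, ha, smul_zero]
  · obtain ⟨d, hd'⟩ := Nat.exists_eq_add_of_le (show n ≤ p.1 by omega)
    have e : b ^ p.1 * (-a) ^ p.2 * (b - a) ^ n =
        (b ^ d * (-a) ^ p.2) * (b ^ n * (b - a) ^ n) := by
      have h1 : Commute (b ^ n) ((-a) ^ p.2) := hba.pow_pow _ _
      rw [hd', add_comm n d, pow_add b, mul_assoc (b ^ d), h1.eq]
      simp only [mul_assoc]
    rw [e, mul_smul, hb, smul_zero]

lemma diffXZ_pow_map (c : ℤ → ℤ → E) (h : ℤ → E →+ E) (q : ℤ) (N : ℕ) :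
    (diffXZ E ^ N) (fun x y z => h y (c (x + q) z)) =
      fun x y z => h y (diffOp^[N] c (x + q) z) := by
  induction N generalizing c with
  | zero => rfl
  | succ N ih =>
    rw [pow_succ, Module.End.mul_apply, Function.iterate_succ_apply, ← ih]
    congr 1
    funext x y z
    simp [diffXZ, diffOp, add_right_comm]

lemma diffYZ_pow_map (c : ℤ → ℤ → E) (h : ℤ → E →+ E) (q : ℤ) (N : ℕ) :
    (diffYZ E ^ N) (fun x y z => h x (c (y + q) z)) =
      fun x y z => h x (diffOp^[N] c (y + q) z) := by
  induction N generalizing c with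
  | zero => rfl
  | succ N ih =>
    rw [pow_succ, Module.End.mul_apply, Function.iterate_succ_apply, ← ih]
    congr 1
    funext x y z
    simp [diffYZ, diffOp, add_right_comm]

lemma diffYZ_pow_apply (f : ℤ → ℤ → ℤ → E) (N : ℕ) (x y z : ℤ) :
    (diffYZ E ^ N) f x y z = diffOp^[N] (f x) y z := by
  induction N generalizing y z with
  | zero => rfl
  | succ N ih =>
    rw [pow_succ', Module.End.mul_apply, Function.iterate_succ_apply', diffOp, ← ih, ← ih]
    rfl

end Dong

/-- Eventual pointwise equality of operator-valued functions. -/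
def EvEq (f : ℤ → ℤ → ℤ → Module.End ℂ V) (g : ℕ → ℤ → ℤ → ℤ → Module.End ℂ V) : Prop :=
  ∀ x y z v, ∃ L₀ : ℕ, ∀ L ≥ L₀, f x y z v = g L x y z v

lemma EvEq.diffXZ {f : ℤ → ℤ → ℤ → Module.End ℂ V} {g : ℕ → ℤ → ℤ → ℤ → Module.End ℂ V}
    (h : EvEq f g) : EvEq (AffineVertex.diffXZ (Module.End ℂ V) f) (fun L => AffineVertex.diffXZ (Module.End ℂ V) (g L)) := by
  intro x y z v
  obtain ⟨L1, h1⟩ := h (x + 1) y z v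
  obtain ⟨L2, h2⟩ := h x y (z + 1) v
  refine ⟨max L1 L2, fun L hL => ?_⟩
  change f (x + 1) y z v - f x y (z + 1) v = g L (x + 1) y z v - g L x y (z + 1) v
  rw [h1 L (le_trans (le_max_left _ _) hL), h2 L (le_trans (le_max_right _ _) hL)]

lemma EvEq.diffYZ {f : ℤ → ℤ → ℤ → Module.End ℂ V} {g : ℕ → ℤ → ℤ → ℤ → Module.End ℂ V}
    (h : EvEq f g) : EvEq (AffineVertex.diffYZ (Module.End ℂ V) f) (fun L => AffineVertex.diffYZ (Module.End ℂ V) (g L)) := by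
  intro x y z v
  obtain ⟨L1, h1⟩ := h x (y + 1) z v
  obtain ⟨L2, h2⟩ := h x y (z + 1) v
  refine ⟨max L1 L2, fun L hL => ?_⟩
  change f x (y + 1) z v - f x y (z + 1) v = g L x (y + 1) z v - g L x y (z + 1) v
  rw [h1 L (le_trans (le_max_left _ _) hL), h2 L (le_trans (le_max_right _ _) hL)]

lemma EvEq.diffXZ_pow {f : ℤ → ℤ → ℤ → Module.End ℂ V} {g : ℕ → ℤ → ℤ → ℤ → Module.End ℂ V}
    (h : EvEq f g) (N : ℕ) :
    EvEq ((AffineVertex.diffXZ (Module.End ℂ V) ^ N) f) (fun L => (AffineVertex.diffXZ (Module.End ℂ V) ^ N) (g L)) := by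
  induction N with
  | zero => exact h
  | succ N ih => simp only [pow_succ', Module.End.mul_apply]; exact EvEq.diffXZ ih

lemma EvEq.diffYZ_pow {f : ℤ → ℤ → ℤ → Module.End ℂ V} {g : ℕ → ℤ → ℤ → ℤ → Module.End ℂ V}
    (h : EvEq f g) (N : ℕ) :
    EvEq ((AffineVertex.diffYZ (Module.End ℂ V) ^ N) f) (fun L => (AffineVertex.diffYZ (Module.End ℂ V) ^ N) (g L)) := by
  induction N with
  | zero => exact h
  | succ N ih => simp only [pow_succ', Module.End.mul_apply]; exact EvEq.diffYZ ih

/-- Commutators of the modes of `(z^x A)_(p) F` with the modes of `G`. -/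
def dongFun (p : ℤ) (A F G : VertexOperator ℂ V) (x y z : ℤ) : Module.End ℂ V :=
  modeComm (fieldProduct p (shiftField x A) F) G y z

lemma dongFun_succ (p : ℤ) (A F G : VertexOperator ℂ V) :
    dongFun (p + 1) A F G = diffXY (Module.End ℂ V) (dongFun p A F G) := by
  funext x y z
  simp only [dongFun, diffXY, LinearMap.coe_mk, AddHom.coe_mk, modeComm, fieldProduct_succ,
    shiftField_shiftField, map_sub, Pi.sub_apply, ncoeff_shiftField, sub_mul, mul_sub]
  abel

lemma dongFun_add (p : ℤ) (s : ℕ) (A F G : VertexOperator ℂ V) :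
    dongFun (p + s) A F G = (diffXY (Module.End ℂ V) ^ s) (dongFun p A F G) := by
  induction s with
  | zero => simp
  | succ s ih =>
    rw [Nat.cast_succ, ← add_assoc, dongFun_succ, ih, pow_succ', Module.End.mul_apply]

/-- Truncated version of `dongFun`. -/
def dongSum (p : ℤ) (A F G : VertexOperator ℂ V) (L : ℕ) : ℤ → ℤ → ℤ → Module.End ℂ V :=
  ∑ i ∈ Finset.range L, ((-1 : ℤ) ^ i * Ring.choose p i) •
    ((fun x y z => ncoeff A (x + (p - i)) * modeComm F G (y + i) z) +
      (fun x y z => modeComm A G (x + (p - i)) z * ncoeff F (y + i)))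
  - ∑ i ∈ Finset.range L, ((p.negOnePow : ℤ) * (-1 : ℤ) ^ i * Ring.choose p i) •
    ((fun x y z => modeComm F G (y + (p - i)) z * ncoeff A (x + i)) +
      (fun x y z => ncoeff F (y + (p - i)) * modeComm A G (x + i) z))

lemma dongSum_apply (p : ℤ) (A F G : VertexOperator ℂ V) (L : ℕ) (x y z : ℤ) (v : V) :
    dongSum p A F G L x y z v =
    (∑ i ∈ Finset.range L, ((-1 : ℤ) ^ i * Ring.choose p i) •
        ncoeff (shiftField x A) (p - i) (ncoeff F (y + i) (ncoeff G z v))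
      - ∑ i ∈ Finset.range L, ((p.negOnePow : ℤ) * (-1 : ℤ) ^ i * Ring.choose p i) •
        ncoeff F (p + y - i) (ncoeff (shiftField x A) i (ncoeff G z v))) -
    ncoeff G z (∑ i ∈ Finset.range L, ((-1 : ℤ) ^ i * Ring.choose p i) •
        ncoeff (shiftField x A) (p - i) (ncoeff F (y + i) v)
      - ∑ i ∈ Finset.range L, ((p.negOnePow : ℤ) * (-1 : ℤ) ^ i * Ring.choose p i) •
        ncoeff F (p + y - i) (ncoeff (shiftField x A) i v)) := by
  rw [map_sub, map_sum, map_sum, sub_sub_sub_comm, ← Finset.sum_sub_distrib,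
    ← Finset.sum_sub_distrib]
  simp only [dongSum, Pi.sub_apply, Finset.sum_apply, LinearMap.sub_apply, LinearMap.sum_apply,
    Pi.smul_apply, LinearMap.smul_apply, Pi.add_apply, LinearMap.add_apply, modeComm,
    Module.End.mul_apply, map_zsmul, ← smul_sub, ncoeff_shiftField, map_sub]
  congr 1
  · refine Finset.sum_congr rfl fun i _ => ?_
    rw [show p - i + x = x + (p - i) by ring]
    congr 1
    abel
  · refine Finset.sum_congr rfl fun i _ => ?_
    rw [show p + y - i = y + (p - i) by ring, add_comm (i : ℤ) x]
    congr 1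
    abel

lemma dong_evEq (p : ℤ) (A F G : VertexOperator ℂ V) :
    EvEq (dongFun p A F G) (dongSum p A F G) := by
  intro x y z v
  obtain ⟨L1, h1⟩ := modes_trunc_nat F y v
  obtain ⟨L2, h2⟩ := modes_trunc_nat F y (ncoeff G z v)
  obtain ⟨L3, h3⟩ := modes_trunc_nat (shiftField x A) 0 v
  obtain ⟨L4, h4⟩ := modes_trunc_nat (shiftField x A) 0 (ncoeff G z v)
  simp only [zero_add] at h3 h4
  refine ⟨L1 + L2 + L3 + L4, fun L hL => ?_⟩
  rw [dongSum_apply, ← fieldProduct_mode p (shiftField x A) F y v (L := L)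
    (fun i hi => h1 i (by omega)) (fun i hi => h3 i (by omega)),
    ← fieldProduct_mode p (shiftField x A) F y (ncoeff G z v) (L := L)
    (fun i hi => h2 i (by omega)) (fun i hi => h4 i (by omega))]
  rfl

lemma dongSum_killed (p : ℤ) (A F G : VertexOperator ℂ V) (L N : ℕ)
    (hA : diffOp^[N] (modeComm A G) = 0) (hF : diffOp^[N] (modeComm F G) = 0) :
    (diffXZ (Module.End ℂ V) ^ N) ((diffYZ (Module.End ℂ V) ^ N) (dongSum p A F G L)) = 0 := by
  have hcomm : Commute (diffXZ (Module.End ℂ V)) (diffYZ (Module.End ℂ V)) := by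
    rw [diffYZ_eq]
    exact (Commute.refl _).sub_right diffXY_comm_diffXZ.symm
  have hYZ : ∀ (h : ℤ → Module.End ℂ V →+ Module.End ℂ V) (q : ℤ), (diffXZ (Module.End ℂ V) ^ N) ((diffYZ (Module.End ℂ V) ^ N)
      (fun x y z => h x (modeComm F G (y + q) z))) = 0 := by
    intro h q
    rw [diffYZ_pow_map, hF]
    convert map_zero (diffXZ (Module.End ℂ V) ^ N) using 2
    funext x y z
    exact map_zero (h x)
  have hXZ : ∀ (h : ℤ → Module.End ℂ V →+ Module.End ℂ V) (q : ℤ), (diffXZ (Module.End ℂ V) ^ N) ((diffYZ (Module.End ℂ V) ^ N)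
      (fun x y z => h y (modeComm A G (x + q) z))) = 0 := by
    intro h q
    rw [← Module.End.mul_apply, (hcomm.pow_pow N N).eq, Module.End.mul_apply, diffXZ_pow_map, hA]
    convert map_zero (diffYZ (Module.End ℂ V) ^ N) using 2
    funext x y z
    exact map_zero (h y)
  rw [dongSum, map_sub, map_sub, map_sum, map_sum, map_sum, map_sum]
  rw [Finset.sum_eq_zero, Finset.sum_eq_zero, sub_zero]
  · intro i _
    rw [map_zsmul, map_zsmul, map_add, map_add]
    exact (congrArg _ ((congrArg₂ (· + ·)
      (hYZ (fun x => AddMonoidHom.mulRight (ncoeff A (x + i))) (p - i))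
      (hXZ (fun y => AddMonoidHom.mulLeft (ncoeff F (y + (p - i)))) i)).trans
        (add_zero _))).trans (smul_zero _)
  · intro i _
    rw [map_zsmul, map_zsmul, map_add, map_add]
    exact (congrArg _ ((congrArg₂ (· + ·)
      (hYZ (fun x => AddMonoidHom.mulLeft (ncoeff A (x + (p - i)))) i)
      (hXZ (fun y => AddMonoidHom.mulRight (ncoeff F (y + i))) (p - i))).trans
        (add_zero _))).trans (smul_zero _)

/-- Dong's lemma. -/
lemma IsLocal.fieldProduct {A F G : VertexOperator ℂ V} (p : ℤ) (hAF : IsLocal A F)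
    (hAG : IsLocal A G) (hFG : IsLocal F G) : IsLocal (fieldProduct p A F) G := by
  obtain ⟨N0, h0⟩ := hAF
  obtain ⟨N1, h1⟩ := hAG
  obtain ⟨N2, h2⟩ := hFG
  set N := max N1 N2
  have key : (diffXZ (Module.End ℂ V) ^ N) ((diffYZ (Module.End ℂ V) ^ N) (dongFun p A F G)) = 0 := by
    funext x y z
    refine LinearMap.ext fun v => ?_
    obtain ⟨L, hL⟩ := ((dong_evEq p A F G).diffYZ_pow N).diffXZ_pow N x y z v
    exact (hL L le_rfl).trans (congrArg (fun f => f x y z v) (dongSum_killed p A F G L N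
      (diffOp_ge h1 (le_max_left _ _)) (diffOp_ge h2 (le_max_right _ _))))
  obtain ⟨s, M, hs, hM⟩ : ∃ s M : ℕ, p + s = M ∧ N0 ≤ M :=
    ⟨(N0 - p).toNat, (p + (N0 - p).toNat).toNat, by omega, by omega⟩
  have key2 : (diffXY (Module.End ℂ V) ^ s) (dongFun p A F G) = 0 := by
    rw [← dongFun_add, hs]
    funext x y z
    rw [dongFun, modeComm, fieldProduct_nat_mode, diffOp_ge h0 hM]
    simp
  have := dong_algebra (R := Module.End ℤ (ℤ → ℤ → ℤ → Module.End ℂ V))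
    diffXY_comm_diffXZ (n := N) (s := s) (t := dongFun p A F G) key2 (by
      rw [← diffYZ_eq]; exact key)
  rw [← diffYZ_eq] at this
  refine ⟨s + N + N, ?_⟩
  funext y z
  have h3 := congrFun (congrFun (congrFun this 0) y) z
  rw [Module.End.smul_def, diffYZ_pow_apply] at h3
  have e : dongFun p A F G 0 = modeComm (AffineVertex.fieldProduct p A F) G := by
    funext y z
    rw [dongFun, shiftField_zero]
  rwa [e] at h3

/-- Translation covariance. -/
def TransCov (T : Module.End ℂ V) (F : VertexOperator ℂ V) : Prop :=
  ∀ n v, T (ncoeff F n v) = ncoeff F n (T v) - n • ncoeff F (n - 1) v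

lemma choose_absorb' (m : ℤ) (i : ℕ) :
    (i + 1) * Ring.choose m (i + 1) = (m - i) * Ring.choose m i := by
  have h2 := Ring.choose_smul_choose m (n := i + 1) (k := i) (by omega)
  simp at h2
  linarith

lemma TransCov.fieldProduct {T : Module.End ℂ V} {A F : VertexOperator ℂ V} (k : ℤ)
    (hA : TransCov T A) (hF : TransCov T F) : TransCov T (fieldProduct k A F) := by
  intro n v
  obtain ⟨L1, h1⟩ := modes_trunc_nat F n v
  obtain ⟨L2, h2⟩ := modes_trunc_nat F n (T v)
  obtain ⟨L3, h3⟩ := modes_trunc_nat A 0 v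
  obtain ⟨L4, h4⟩ := modes_trunc_nat A 0 (T v)
  obtain ⟨L5, h5⟩ := modes_trunc_nat F (n - 1) v
  obtain ⟨L6, h6⟩ := modes_trunc_nat A (-1) v
  simp only [zero_add] at h3 h4
  set L := L1 + L2 + L3 + L4 + L5 + L6
  rw [fieldProduct_mode k A F n v (L := L + 1) (fun i hi => h1 i (by omega))
      (fun i hi => h3 i (by omega)),
    fieldProduct_mode k A F n (T v) (L := L + 1) (fun i hi => h2 i (by omega))
      (fun i hi => h4 i (by omega)),
    fieldProduct_mode k A F (n - 1) v (L := L + 1) (fun i hi => h5 i (by omega))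
      (fun i hi => h3 i (by omega))]
  rw [map_sub, map_sum, map_sum, smul_sub, Finset.smul_sum, Finset.smul_sum]
  have e1 : ∑ i ∈ Finset.range (L + 1), T (((-1 : ℤ) ^ i * Ring.choose k i) •
        ncoeff A (k - i) (ncoeff F (n + i) v)) =
      ∑ i ∈ Finset.range (L + 1), ((-1 : ℤ) ^ i * Ring.choose k i) •
        ncoeff A (k - i) (ncoeff F (n + i) (T v)) -
      ∑ i ∈ Finset.range (L + 1), n • ((-1 : ℤ) ^ i * Ring.choose k i) •
        ncoeff A (k - i) (ncoeff F (n - 1 + i) v) := by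
    have e : ∀ i : ℕ, T (((-1 : ℤ) ^ i * Ring.choose k i) •
        ncoeff A (k - i) (ncoeff F (n + i) v)) =
      ((-1 : ℤ) ^ i * Ring.choose k i) • ncoeff A (k - i) (ncoeff F (n + i) (T v)) -
      (((-1 : ℤ) ^ i * Ring.choose k i * (n + i)) •
        ncoeff A (k - i) (ncoeff F (n - 1 + i) v) +
      ((-1 : ℤ) ^ i * Ring.choose k i * (k - i)) •
        ncoeff A (k - (i + 1 : ℕ)) (ncoeff F (n - 1 + (i + 1 : ℕ)) v)) := by
      intro i
      rw [map_zsmul, hA, hF, map_sub, map_zsmul,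
        show k - ((i + 1 : ℕ) : ℤ) = k - i - 1 by push_cast; ring,
        show n - 1 + ((i + 1 : ℕ) : ℤ) = n + i by push_cast; ring,
        show n + (i : ℤ) - 1 = n - 1 + i by ring]
      module
    rw [Finset.sum_congr rfl fun i _ => e i, Finset.sum_sub_distrib, Finset.sum_add_distrib,
      Finset.sum_range_succ (fun i => ((-1 : ℤ) ^ i * Ring.choose k i * (k - i)) •
        ncoeff A (k - (i + 1 : ℕ)) (ncoeff F (n - 1 + (i + 1 : ℕ)) v)) L,
      h5 (L + 1) (by omega), map_zero, smul_zero, add_zero]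
    congr 1
    rw [Finset.sum_range_succ', Finset.sum_range_succ' _ L, add_right_comm,
      ← Finset.sum_add_distrib]
    congr 1
    · refine Finset.sum_congr rfl fun i _ => ?_
      rw [← add_smul, smul_smul]
      congr 1
      have := choose_absorb' k i
      push_cast
      rw [pow_succ]
      linear_combination (-(-1) ^ i) * this
    · simp
  have e2 : ∑ i ∈ Finset.range (L + 1), T (((k.negOnePow : ℤ) * (-1 : ℤ) ^ i * Ring.choose k i) •
        ncoeff F (k + n - i) (ncoeff A i v)) =
      ∑ i ∈ Finset.range (L + 1), ((k.negOnePow : ℤ) * (-1 : ℤ) ^ i * Ring.choose k i) •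
        ncoeff F (k + n - i) (ncoeff A i (T v)) -
      ∑ i ∈ Finset.range (L + 1), n • ((k.negOnePow : ℤ) * (-1 : ℤ) ^ i * Ring.choose k i) •
        ncoeff F (k + (n - 1) - i) (ncoeff A i v) := by
    have e : ∀ i : ℕ, T (((k.negOnePow : ℤ) * (-1 : ℤ) ^ i * Ring.choose k i) •
        ncoeff F (k + n - i) (ncoeff A i v)) =
      ((k.negOnePow : ℤ) * (-1 : ℤ) ^ i * Ring.choose k i) •
        ncoeff F (k + n - i) (ncoeff A i (T v)) -
      (((k.negOnePow : ℤ) * (-1 : ℤ) ^ i * Ring.choose k i * (k + n - i)) •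
        ncoeff F (k + (n - 1) - i) (ncoeff A i v) +
      ((k.negOnePow : ℤ) * (-1 : ℤ) ^ i * Ring.choose k i * i) •
        ncoeff F (k + n - i) (ncoeff A (i - 1) v)) := by
      intro i
      rw [map_zsmul, hF, hA, map_sub, map_zsmul,
        show k + n - (i : ℤ) - 1 = k + (n - 1) - i by ring]
      module
    rw [Finset.sum_congr rfl fun i _ => e i, Finset.sum_sub_distrib, Finset.sum_add_distrib,
      Finset.sum_range_succ' (fun i : ℕ => ((k.negOnePow : ℤ) * (-1 : ℤ) ^ i *
        Ring.choose k i * i) • ncoeff F (k + n - i) (ncoeff A (i - 1) v)) L]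
    congr 1
    rw [Nat.cast_zero, mul_zero, zero_smul, add_zero, Finset.sum_range_succ,
      Finset.sum_range_succ _ L, add_right_comm, h3 L (by omega), map_zero, smul_zero, smul_zero,
      smul_zero, add_zero, add_zero, ← Finset.sum_add_distrib]
    refine Finset.sum_congr rfl fun i _ => ?_
    rw [show k + n - ((i + 1 : ℕ) : ℤ) = k + (n - 1) - i by push_cast; ring,
      show ((i + 1 : ℕ) : ℤ) - 1 = i by push_cast; ring, ← add_smul, smul_smul]
    congr 1
    have := choose_absorb' k i
    push_cast
    rw [pow_succ]
    linear_combination (-(-1) ^ i * (k.negOnePow : ℤ)) * this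
  rw [e1, e2]
  abel

lemma eq_of_local_of_vacuum {F : VertexOperator ℂ V} {vac : V} {Y : V → VertexOperator ℂ V}
    (hY : ∀ v, ncoeff (Y v) (-1) vac = v) (hY' : ∀ v (n : ℕ), ncoeff (Y v) n vac = 0)
    (hF : ∀ n, ncoeff F n vac = 0) (hloc : ∀ v, IsLocal F (Y v)) : F = 0 := by
  apply modes_ext
  intro m w
  obtain ⟨N, hN⟩ := hloc w
  have h := congrArg (fun f : Module.End ℂ V => f vac)
    (fieldProduct_nat_mode N F (Y w) (m - N) (-1))
  simp only [hN, Pi.zero_apply, LinearMap.zero_apply] at h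
  rw [fieldProduct_mode N (shiftField (m - N) F) (Y w) (-1) vac (L := 1) (fun i hi => by
      have := hY' w (i - 1)
      rwa [Nat.cast_sub hi, Nat.cast_one, ← neg_add_eq_sub] at this)
    (fun i _ => by rw [ncoeff_shiftField, hF])] at h
  simpa [hF, hY] using h

end Fields

/-! ## The affine Lie algebra and its vacuum module -/

section Affine

/-- A nondegenerate symmetric invariant bilinear form on a complex Lie algebra. -/
structure InvariantForm (𝔤 : Type*) [LieRing 𝔤] [LieAlgebra ℂ 𝔤] where
  form : LinearMap.BilinForm ℂ 𝔤
  symm : form.IsSymm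
  nondegenerate : form.Nondegenerate
  invariant : form.lieInvariant 𝔤

variable {𝔤 : Type*} [LieRing 𝔤] [LieAlgebra ℂ 𝔤]

lemma InvariantForm.neg_invariant (κ : InvariantForm 𝔤) : (-κ.form).lieInvariant 𝔤 :=
  fun x y z => by
    have := κ.invariant x y z
    simp [this]

lemma InvariantForm.neg_symm (κ : InvariantForm 𝔤) : (-κ.form).IsSymm :=
  ⟨fun x y => by simp [κ.symm.eq x y]⟩

/-- The affine Lie algebra `ĝ = 𝔤 ⊗ ℂ[t, t⁻¹] ⊕ ℂ K`. Mathlib's cocycle for a form `B` is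
`(a ⊗ t^m, b ⊗ t^n) ↦ n δ_{m,-n} B(a, b)`, whence the sign; see `current_lie_current`. -/
def AffineAlgebra (κ : InvariantForm 𝔤) : Type _ :=
  LieAlgebra.ofTwoCocycle (LieAlgebra.LoopAlgebra.twoCocycleOfBilinear ℂ ℤ 𝔤 (-κ.form)
    κ.neg_invariant κ.neg_symm)

variable (κ : InvariantForm 𝔤)

instance : LieRing (AffineAlgebra κ) := inferInstanceAs (LieRing (LieAlgebra.ofTwoCocycle _))

instance : LieAlgebra ℂ (AffineAlgebra κ) :=
  inferInstanceAs (LieAlgebra ℂ (LieAlgebra.ofTwoCocycle _))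

/-- The element `x + c K` of the affine algebra, for `x` in the loop algebra and `c ∈ ℂ`. -/
def affineMk (x : LieAlgebra.loopAlgebra ℂ ℤ 𝔤) (c : ℂ) : AffineAlgebra κ :=
  LieAlgebra.ofProd _ (x, (TrivialLieModule.equiv ℂ _ ℂ).symm c)

/-- The loop algebra component. -/
def loopPart : AffineAlgebra κ →ₗ[ℂ] LieAlgebra.loopAlgebra ℂ ℤ 𝔤 where
  toFun x := ((LieAlgebra.ofProd _).symm x).1
  map_add' _ _ := rfl
  map_smul' _ _ := rfl

/-- The coefficient of `K`. -/
def centralPart : AffineAlgebra κ →ₗ[ℂ] ℂ where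
  toFun x := TrivialLieModule.equiv ℂ _ ℂ ((LieAlgebra.ofProd _).symm x).2
  map_add' _ _ := rfl
  map_smul' _ _ := rfl

/-- The element `a ⊗ t^n`. -/
def current (n : ℤ) (a : 𝔤) : AffineAlgebra κ := affineMk κ (AddMonoidAlgebra.single n 1 ⊗ₜ[ℂ] a) 0

/-- The central element `K`. -/
def central : AffineAlgebra κ := affineMk κ 0 1

lemma affineMk_add (x y : LieAlgebra.loopAlgebra ℂ ℤ 𝔤) (c d : ℂ) :
    affineMk κ (x + y) (c + d) = affineMk κ x c + affineMk κ y d := rfl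

lemma affineMk_smul (x : LieAlgebra.loopAlgebra ℂ ℤ 𝔤) (c d : ℂ) :
    affineMk κ (c • x) (c * d) = c • affineMk κ x d := rfl

lemma affineMk_lie (x y : LieAlgebra.loopAlgebra ℂ ℤ 𝔤) (c d : ℂ) :
    ⁅affineMk κ x c, affineMk κ y d⁆ =
      affineMk κ ⁅x, y⁆ (LieAlgebra.LoopAlgebra.residuePairing ℂ ℤ 𝔤 (-κ.form) x y) := by
  refine (LieAlgebra.bracket_ofTwoCocycle _ _).trans ?_
  refine congrArg (LieAlgebra.ofProd _) (Prod.ext rfl ?_)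
  dsimp only
  rw [LieModule.IsTrivial.trivial, LieModule.IsTrivial.trivial, sub_zero, add_zero]
  rfl

lemma smul_central (c : ℂ) : c • central κ = affineMk κ 0 c := by
  rw [central, ← affineMk_smul, smul_zero, mul_one]

lemma current_add (n : ℤ) (a b : 𝔤) : current κ n (a + b) = current κ n a + current κ n b := by
  rw [current, current, current, ← affineMk_add, TensorProduct.tmul_add, add_zero]

lemma current_smul (n : ℤ) (c : ℂ) (a : 𝔤) : current κ n (c • a) = c • current κ n a := by
  rw [current, current, ← affineMk_smul, TensorProduct.tmul_smul, mul_zero]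

/-- `[a ⊗ t^m, b ⊗ t^n] = [a, b] ⊗ t^{m+n} + m δ_{m,-n} (a|b) K`. -/
theorem current_lie_current (m n : ℤ) (a b : 𝔤) :
    ⁅current κ m a, current κ n b⁆ =
      current κ (m + n) ⁅a, b⁆ + (if m + n = 0 then (m : ℂ) * κ.form a b else 0) • central κ := by
  rw [current, current, affineMk_lie, smul_central, current, ← affineMk_add, add_zero, zero_add,
    LieAlgebra.ExtendScalars.bracket_tmul, AddMonoidAlgebra.single_mul_single, mul_one,
    LieAlgebra.LoopAlgebra.residuePairing_apply_apply,
    LieAlgebra.LoopAlgebra.toFinsupp_single_tmul,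
    LieAlgebra.LoopAlgebra.toFinsupp_single_tmul, Finsupp.sum_single_index (by simp)]
  congr 1
  by_cases h : m + n = 0
  · obtain rfl : n = -m := by omega
    simp
  · rw [Finsupp.single_eq_of_ne (by omega), if_neg h]
    simp

theorem central_lie (x : AffineAlgebra κ) : ⁅central κ, x⁆ = 0 := by
  change ⁅affineMk κ 0 1, affineMk κ (loopPart κ x) (centralPart κ x)⁆ = _
  rw [affineMk_lie]
  refine (congrArg₂ (affineMk κ) (zero_lie (L := LieAlgebra.loopAlgebra ℂ ℤ 𝔤) (loopPart κ x)) ?_ :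
    _ = affineMk κ 0 0)
  rw [map_zero, LinearMap.zero_apply]

lemma affine_induction {p : AffineAlgebra κ → Prop} (hadd : ∀ x y, p x → p y → p (x + y))
    (hcur : ∀ m a, p (current κ m a)) (hcen : ∀ c : ℂ, p (c • central κ)) (x) : p x := by
  have h0 : p (affineMk κ 0 0) := by
    rw [← smul_central]
    exact hcen 0
  have h1 : ∀ y, p (affineMk κ y 0) := by
    intro y
    induction y using TensorProduct.induction_on with
    | zero => exact h0
    | add y z hy hz =>
      have := hadd _ _ hy hz
      rwa [← affineMk_add, add_zero] at this
    | tmul f a =>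
      induction f using AddMonoidAlgebra.induction_linear with
      | zero => rwa [TensorProduct.zero_tmul]
      | add f g hf hg =>
        have := hadd _ _ hf hg
        rwa [← affineMk_add, add_zero, ← TensorProduct.add_tmul] at this
      | single m r =>
        have := hcur m (r • a)
        rwa [current, ← TensorProduct.smul_tmul, AddMonoidAlgebra.smul_single, smul_eq_mul,
          mul_one] at this
  have h2 := hadd _ _ (h1 (loopPart κ x)) (hcen (centralPart κ x))
  rwa [smul_central, ← affineMk_add, add_zero, zero_add] at h2

section Lift

variable {W : Type*} [AddCommGroup W] [Module ℂ W]

/-- Operators `J n a` on `W` satisfying the relations of the affine algebra, with `K = k`. -/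
def IsLevelAction (k : ℂ) (J : ℤ → 𝔤 →ₗ[ℂ] Module.End ℂ W) : Prop :=
  ∀ (m n : ℤ) (a b : 𝔤), J m a * J n b - J n b * J m a =
    J (m + n) ⁅a, b⁆ + (if m + n = 0 then (m : ℂ) * κ.form a b * k else 0) • 1

variable {κ}

/-- The linear map `ĝ → End W` with `a ⊗ t^n ↦ J n a` and `K ↦ k`. -/
def levelLinear (k : ℂ) (J : ℤ → 𝔤 →ₗ[ℂ] Module.End ℂ W) :
    AffineAlgebra κ →ₗ[ℂ] Module.End ℂ W :=
  Finsupp.lsum ℂ J ∘ₗ (LieAlgebra.LoopAlgebra.toFinsupp ℂ ℤ 𝔤).toLinearMap ∘ₗ loopPart κ +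
    (LinearMap.toSpanSingleton ℂ (Module.End ℂ W) (k • 1)) ∘ₗ centralPart κ

lemma levelLinear_current (k : ℂ) (J : ℤ → 𝔤 →ₗ[ℂ] Module.End ℂ W) (m : ℤ) (a : 𝔤) :
    levelLinear (κ := κ) k J (current κ m a) = J m a := by
  change Finsupp.lsum ℂ J (LieAlgebra.LoopAlgebra.toFinsupp ℂ ℤ 𝔤
    (AddMonoidAlgebra.single m 1 ⊗ₜ[ℂ] a)) + (0 : ℂ) • (k • (1 : Module.End ℂ W)) = _
  rw [LieAlgebra.LoopAlgebra.toFinsupp_single_tmul]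
  simp

lemma levelLinear_central (k : ℂ) (J : ℤ → 𝔤 →ₗ[ℂ] Module.End ℂ W) :
    levelLinear (κ := κ) k J (central κ) = k • 1 := by
  change Finsupp.lsum ℂ J (LieAlgebra.LoopAlgebra.toFinsupp ℂ ℤ 𝔤 0) +
    (1 : ℂ) • (k • (1 : Module.End ℂ W)) = _
  rw [map_zero, map_zero, zero_add, one_smul]

/-- The representation of the affine algebra. -/
def levelRep (k : ℂ) (J : ℤ → 𝔤 →ₗ[ℂ] Module.End ℂ W) (hJ : IsLevelAction κ k J) :
    AffineAlgebra κ →ₗ⁅ℂ⁆ Module.End ℂ W :=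
  { levelLinear (κ := κ) k J with
    map_lie' := by
      intro x y
      change levelLinear k J ⁅x, y⁆ = ⁅levelLinear k J x, levelLinear k J y⁆
      induction x using affine_induction with
      | hadd x x' hx hx' => rw [add_lie, map_add, hx, hx', map_add, add_lie]
      | hcen c =>
        rw [smul_lie, central_lie, smul_zero, map_zero, map_smul, levelLinear_central]
        simp [LieRing.of_associative_ring_bracket]
      | hcur m a =>
        induction y using affine_induction with
        | hadd x x' hx hx' => rw [lie_add, map_add, hx, hx', map_add, lie_add]
        | hcen c =>
          rw [← lie_skew, smul_lie, central_lie, smul_zero, neg_zero, map_zero, map_smul,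
            levelLinear_central]
          simp [LieRing.of_associative_ring_bracket]
        | hcur n b =>
          rw [current_lie_current, map_add, map_smul, levelLinear_central, levelLinear_current,
            levelLinear_current, levelLinear_current, LieRing.of_associative_ring_bracket, hJ,
            smul_smul, ite_mul, zero_mul] }

lemma levelRep_current (k : ℂ) (J : ℤ → 𝔤 →ₗ[ℂ] Module.End ℂ W) (hJ : IsLevelAction κ k J)
    (m : ℤ) (a : 𝔤) : levelRep k J hJ (current κ m a) = J m a := levelLinear_current k J m a

lemma levelRep_central (k : ℂ) (J : ℤ → 𝔤 →ₗ[ℂ] Module.End ℂ W) (hJ : IsLevelAction κ k J) :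
    levelRep k J hJ (central κ) = k • 1 := levelLinear_central k J

end Lift

section Vacuum

variable (k : ℂ)

/-- The left ideal of `U(ĝ)` generated by `a ⊗ t^n`, `n ≥ 0`, and `K - k`. -/
def vacuumIdeal : Submodule (UniversalEnvelopingAlgebra ℂ (AffineAlgebra κ))
    (UniversalEnvelopingAlgebra ℂ (AffineAlgebra κ)) :=
  Submodule.span _
    ({x | ∃ n : ℤ, 0 ≤ n ∧ ∃ a : 𝔤, x = UniversalEnvelopingAlgebra.ι ℂ (current κ n a)} ∪
      {UniversalEnvelopingAlgebra.ι ℂ (central κ) - algebraMap ℂ _ k})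

/-- The space `V_k(𝔤)`: the `ĝ`-module induced from the one-dimensional module of `𝔤[t] ⊕ ℂ K` on
which `𝔤[t]` acts by `0` and `K` by `k`, that is, `U(ĝ)` modulo the left ideal above. -/
def VacuumModule : Type _ :=
  UniversalEnvelopingAlgebra ℂ (AffineAlgebra κ) ⧸ vacuumIdeal κ k

instance : AddCommGroup (VacuumModule κ k) :=
  inferInstanceAs (AddCommGroup (_ ⧸ vacuumIdeal κ k))

instance : Module (UniversalEnvelopingAlgebra ℂ (AffineAlgebra κ)) (VacuumModule κ k) :=
  inferInstanceAs (Module _ (_ ⧸ vacuumIdeal κ k))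

instance : Module ℂ (VacuumModule κ k) :=
  inferInstanceAs (Module ℂ (_ ⧸ vacuumIdeal κ k))

instance : IsScalarTower ℂ (UniversalEnvelopingAlgebra ℂ (AffineAlgebra κ)) (VacuumModule κ k) :=
  inferInstanceAs (IsScalarTower ℂ _ (_ ⧸ vacuumIdeal κ k))

/-- The vacuum vector, the class of `1`. -/
def vacuum : VacuumModule κ k := Submodule.Quotient.mk (p := vacuumIdeal κ k) 1

/-- The action of `a ⊗ t^n` on the vacuum module. -/
def vacuumMode (n : ℤ) : 𝔤 →ₗ[ℂ] Module.End ℂ (VacuumModule κ k) where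
  toFun a := Algebra.lsmul ℂ ℂ (VacuumModule κ k) (UniversalEnvelopingAlgebra.ι ℂ (current κ n a))
  map_add' a b := by rw [current_add, map_add, map_add]
  map_smul' c a := by rw [current_smul, map_smul, map_smul, RingHom.id_apply]

variable {κ k}

lemma vacuumMode_apply (n : ℤ) (a : 𝔤) (v : VacuumModule κ k) :
    vacuumMode κ k n a v = UniversalEnvelopingAlgebra.ι ℂ (current κ n a) • v := rfl

lemma ι_mul_sub (x y : AffineAlgebra κ) :
    UniversalEnvelopingAlgebra.ι ℂ x * UniversalEnvelopingAlgebra.ι ℂ y -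
      UniversalEnvelopingAlgebra.ι ℂ y * UniversalEnvelopingAlgebra.ι ℂ x =
      UniversalEnvelopingAlgebra.ι ℂ ⁅x, y⁆ := by
  rw [LieHom.map_lie, LieRing.of_associative_ring_bracket]

lemma vacuum_generates (v : VacuumModule κ k) :
    ∃ u : UniversalEnvelopingAlgebra ℂ (AffineAlgebra κ), u • vacuum κ k = v := by
  obtain ⟨u, rfl⟩ := Submodule.Quotient.mk_surjective (vacuumIdeal κ k) v
  refine ⟨u, ?_⟩
  change Submodule.Quotient.mk (u • (1 : UniversalEnvelopingAlgebra ℂ (AffineAlgebra κ))) = _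
  rw [smul_eq_mul, mul_one]

lemma mk_eq_smul (u : UniversalEnvelopingAlgebra ℂ (AffineAlgebra κ)) :
    (Submodule.Quotient.mk (p := vacuumIdeal κ k) u : VacuumModule κ k) = u • vacuum κ k := by
  change _ = Submodule.Quotient.mk (u • (1 : UniversalEnvelopingAlgebra ℂ (AffineAlgebra κ)))
  rw [smul_eq_mul, mul_one]

lemma env_induction {p : UniversalEnvelopingAlgebra ℂ (AffineAlgebra κ) → Prop}
    (halg : ∀ c, p (algebraMap ℂ _ c)) (hadd : ∀ x y, p x → p y → p (x + y))
    (hmul : ∀ x y, p x → p y → p (x * y)) (hι : ∀ x, p (UniversalEnvelopingAlgebra.ι ℂ x))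
    (u) : p u := by
  obtain ⟨t, rfl⟩ := RingCon.mkₐ_surjective (α := ℂ)
    (UniversalEnvelopingAlgebra.ringCon ℂ (AffineAlgebra κ)) u
  change p (UniversalEnvelopingAlgebra.mkAlgHom ℂ _ t)
  induction t using TensorAlgebra.induction with
  | algebraMap r => rw [AlgHom.commutes]; exact halg r
  | ι x => exact hι x
  | mul a b ha hb => rw [map_mul]; exact hmul _ _ ha hb
  | add a b ha hb => rw [map_add]; exact hadd _ _ ha hb

lemma central_smul (v : VacuumModule κ k) :
    UniversalEnvelopingAlgebra.ι ℂ (central κ) • v = k • v := by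
  obtain ⟨u, rfl⟩ := vacuum_generates v
  have hc : UniversalEnvelopingAlgebra.ι ℂ (central κ) * u =
      u * UniversalEnvelopingAlgebra.ι ℂ (central κ) := by
    induction u using env_induction with
    | halg c => exact (Algebra.commutes c _).symm
    | hadd x y hx hy => rw [mul_add, add_mul, hx, hy]
    | hmul x y hx hy => rw [← mul_assoc, hx, mul_assoc, hy, mul_assoc]
    | hι x =>
      rw [← sub_eq_zero, ι_mul_sub, central_lie, map_zero]
  have h0 : (UniversalEnvelopingAlgebra.ι ℂ (central κ) - algebraMap ℂ _ k) • vacuum κ k = 0 := by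
    rw [← mk_eq_smul]
    exact (Submodule.Quotient.mk_eq_zero _).2 (Submodule.subset_span (Or.inr rfl))
  rw [sub_smul, sub_eq_zero, algebraMap_smul] at h0
  rw [← mul_smul, hc, mul_smul, h0, smul_comm]

lemma vacuumMode_level : IsLevelAction κ k (vacuumMode κ k) := by
  intro m n a b
  ext v
  simp only [LinearMap.sub_apply, Module.End.mul_apply, LinearMap.add_apply, LinearMap.smul_apply,
    vacuumMode_apply, Module.End.one_apply]
  rw [← mul_smul, ← mul_smul, ← sub_smul, ι_mul_sub, current_lie_current, map_add, add_smul,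
    map_smul, smul_assoc, central_smul, smul_smul, ite_mul, zero_mul]

lemma vacuumMode_vacuum {n : ℤ} (hn : 0 ≤ n) (a : 𝔤) : vacuumMode κ k n a (vacuum κ k) = 0 := by
  rw [vacuumMode_apply, ← mk_eq_smul]
  exact (Submodule.Quotient.mk_eq_zero _).2 (Submodule.subset_span (Or.inl ⟨n, hn, a, rfl⟩))

/-- The vacuum module is spanned by the vectors obtained from the vacuum by applying modes. -/
lemma vacuum_induction {p : VacuumModule κ k → Prop} (hvac : p (vacuum κ k))
    (hadd : ∀ x y, p x → p y → p (x + y)) (hsmul : ∀ (c : ℂ) x, p x → p (c • x))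
    (hmode : ∀ n a x, p x → p (vacuumMode κ k n a x)) (v) : p v := by
  obtain ⟨u, rfl⟩ := vacuum_generates v
  suffices ∀ x, p x → p (u • x) from this _ hvac
  induction u using env_induction with
  | halg c => intro x hx; rw [algebraMap_smul]; exact hsmul c x hx
  | hadd u u' h h' => intro x hx; rw [add_smul]; exact hadd _ _ (h x hx) (h' x hx)
  | hmul u u' h h' => intro x hx; rw [mul_smul]; exact h _ (h' x hx)
  | hι y =>
    intro x hx
    induction y using affine_induction with
    | hadd y y' h h' => rw [map_add, add_smul]; exact hadd _ _ h h'
    | hcur m a => exact hmode m a x hx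
    | hcen c =>
      rw [map_smul, smul_assoc, central_smul]
      exact hsmul c _ (hsmul k _ hx)

section Lift

variable {W : Type*} [AddCommGroup W] [Module ℂ W] (J : ℤ → 𝔤 →ₗ[ℂ] Module.End ℂ W)
  (hJ : IsLevelAction κ k J) (w : W) (hw : ∀ n : ℤ, 0 ≤ n → ∀ a, J n a w = 0)

/-- Universal property of the vacuum module: the linear map with `1 ↦ w` that intertwines the action
of `a ⊗ t^n` with `J n a`. -/
def vacuumLift : VacuumModule κ k →ₗ[ℂ] W :=
  ((vacuumIdeal κ k).restrictScalars ℂ).liftQ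
    ((LinearMap.applyₗ w).comp (UniversalEnvelopingAlgebra.lift ℂ (levelRep k J hJ)).toLinearMap)
    (by
      intro x hx
      rw [Submodule.restrictScalars_mem] at hx
      change UniversalEnvelopingAlgebra.lift ℂ (levelRep k J hJ) x w = 0
      induction hx using Submodule.span_induction with
      | zero => simp
      | add x y _ _ hx hy => rw [map_add, LinearMap.add_apply, hx, hy, add_zero]
      | smul u x _ hx => rw [smul_eq_mul, map_mul, Module.End.mul_apply, hx, map_zero]
      | mem x hx =>
        rcases hx with ⟨n, hn, a, rfl⟩ | rfl
        · rw [UniversalEnvelopingAlgebra.lift_ι_apply, levelRep_current, hw n hn]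
        · rw [map_sub, UniversalEnvelopingAlgebra.lift_ι_apply, levelRep_central, AlgHom.commutes,
            ← Algebra.algebraMap_eq_smul_one, sub_self, LinearMap.zero_apply]) ∘ₗ
  (Submodule.Quotient.restrictScalarsEquiv ℂ (vacuumIdeal κ k)).symm.toLinearMap

lemma vacuumLift_smul (u) : vacuumLift J hJ w hw (u • vacuum κ k) =
    UniversalEnvelopingAlgebra.lift ℂ (levelRep k J hJ) u w := by
  rw [← mk_eq_smul]
  rfl

lemma vacuumLift_vacuum : vacuumLift J hJ w hw (vacuum κ k) = w := by
  have := vacuumLift_smul J hJ w hw 1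
  rwa [one_smul, map_one, Module.End.one_apply] at this

lemma vacuumLift_mode (n : ℤ) (a : 𝔤) (v : VacuumModule κ k) :
    vacuumLift J hJ w hw (vacuumMode κ k n a v) = J n a (vacuumLift J hJ w hw v) := by
  obtain ⟨u, rfl⟩ := vacuum_generates v
  rw [vacuumMode_apply, ← mul_smul, vacuumLift_smul, vacuumLift_smul, map_mul,
    UniversalEnvelopingAlgebra.lift_ι_apply, levelRep_current, Module.End.mul_apply]

end Lift

end Vacuum

end Affine

/-! ## Vertex algebras and the universal affine vertex algebra -/

/-- A vertex algebra: a vacuum vector `1` and a state-field correspondence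
`Y(a, z) = ∑ₙ a_(n) z^(-n-1)` with `Y(1, z) = id`, `a_(-1) 1 = a`, `a_(n) 1 = 0` for `n ≥ 0`, and the
Borcherds identity. (That `a_(n) b = 0` for large `n` is part of `VertexOperator`.) -/
structure VertexAlgebra (V : Type*) [AddCommGroup V] [Module ℂ V] where
  vacuum : V
  Y : V →ₗ[ℂ] VertexOperator ℂ V
  vacuum_mode : ∀ n, ncoeff (Y vacuum) n = if n = -1 then 1 else 0
  mode_vacuum : ∀ a, ncoeff (Y a) (-1) vacuum = a
  mode_vacuum_of_nonneg : ∀ a (n : ℤ), 0 ≤ n → ncoeff (Y a) n vacuum = 0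
  borcherds : ∀ (a b c : V) (k m n : ℤ),
    ∑ᶠ j : ℕ, Ring.choose m j • ncoeff (Y (ncoeff (Y a) (k + j) b)) (m + n - j) c =
      ∑ᶠ i : ℕ, ((-1 : ℤ) ^ i * Ring.choose k i) •
        ncoeff (Y a) (m + k - i) (ncoeff (Y b) (n + i) c) -
      ∑ᶠ i : ℕ, ((k.negOnePow : ℤ) * (-1 : ℤ) ^ i * Ring.choose k i) •
        ncoeff (Y b) (n + k - i) (ncoeff (Y a) (m + i) c)

section Reconstruction

variable {V : Type*} [AddCommGroup V] [Module ℂ V] (Y : V →ₗ[ℂ] VertexOperator ℂ V)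

/-- Left-hand side of the Borcherds identity. -/
def borcherdsLeft (a b c : V) (k m n : ℤ) : V :=
  ∑ᶠ j : ℕ, Ring.choose m j • ncoeff (Y (ncoeff (Y a) (k + j) b)) (m + n - j) c

lemma borcherdsLeft_eq (a b c : V) (k m n : ℤ) {L : ℕ}
    (hL : ∀ i ≥ L, ncoeff (Y a) (k + (i : ℕ)) b = 0) :
    borcherdsLeft Y a b c k m n = ∑ j ∈ Finset.range L,
      Ring.choose m j • ncoeff (Y (ncoeff (Y a) (k + j) b)) (m + n - j) c :=
  finsum_eq_range (fun i hi => by simp [hL i hi])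

lemma borcherdsLeft_succ (a b c : V) (k m n : ℤ) :
    borcherdsLeft Y a b c k (m + 1) n =
      borcherdsLeft Y a b c (k + 1) m n + borcherdsLeft Y a b c k m (n + 1) := by
  obtain ⟨L, hL⟩ := modes_trunc_nat (Y a) k b
  have hL' : ∀ i ≥ L + 1, ncoeff (Y a) (k + (i : ℕ)) b = 0 := fun i hi => hL i (by omega)
  rw [borcherdsLeft_eq Y a b c k (m + 1) n hL', borcherdsLeft_eq Y a b c k m (n + 1) hL',
    borcherdsLeft_eq Y a b c (k + 1) m n (L := L) (fun i hi => by
      have := hL (i + 1) (by omega)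
      rwa [Nat.cast_add, Nat.cast_one, add_comm (i : ℤ), ← add_assoc] at this),
    Finset.sum_range_succ', Finset.sum_range_succ' _ L, ← add_assoc, ← Finset.sum_add_distrib]
  congr 1
  · refine Finset.sum_congr rfl fun i _ => ?_
    rw [Ring.choose_succ_succ, show k + 1 + (i : ℤ) = k + ((i + 1 : ℕ) : ℤ) by push_cast; ring,
      show m + 1 + n - ((i + 1 : ℕ) : ℤ) = m + n - i by push_cast; ring,
      show m + (n + 1) - ((i + 1 : ℕ) : ℤ) = m + n - i by push_cast; ring, add_smul]
  · simp [add_assoc, add_comm (1 : ℤ) n]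

lemma fieldProduct_shift_mode (A F : VertexOperator ℂ V) (k m n : ℤ) (c : V) :
    ncoeff (fieldProduct k (shiftField m A) F) n c =
      ∑ᶠ i : ℕ, ((-1 : ℤ) ^ i * Ring.choose k i) • ncoeff A (m + k - i) (ncoeff F (n + i) c) -
      ∑ᶠ i : ℕ, ((k.negOnePow : ℤ) * (-1 : ℤ) ^ i * Ring.choose k i) •
        ncoeff F (n + k - i) (ncoeff A (m + i) c) := by
  obtain ⟨L1, h1⟩ := modes_trunc_nat F n c
  obtain ⟨L2, h2⟩ := modes_trunc_nat A m c
  rw [fieldProduct_mode k _ F n c (L := L1 + L2) (fun i hi => h1 i (by omega)) (fun i hi => by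
      rw [ncoeff_shiftField, add_comm, h2 i (by omega)]),
    finsum_eq_range (L := L1 + L2) (fun i hi => by rw [h1 i (by omega), map_zero, smul_zero]),
    finsum_eq_range (L := L1 + L2) (fun i hi => by rw [h2 i (by omega), map_zero, smul_zero])]
  congr 1
  · refine Finset.sum_congr rfl fun i _ => ?_
    rw [ncoeff_shiftField, show k - (i : ℤ) + m = m + k - i by ring]
  · refine Finset.sum_congr rfl fun i _ => ?_
    rw [ncoeff_shiftField, add_comm k n, add_comm (i : ℤ) m]

/-- Locality together with the formula for the products implies the Borcherds identity. -/
lemma borcherds_of_local (hit : ∀ a b k, Y (ncoeff (Y a) k b) = fieldProduct k (Y a) (Y b))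
    (hloc : ∀ a b, IsLocal (Y a) (Y b)) (a b c : V) (k m n : ℤ) :
    borcherdsLeft Y a b c k m n = ncoeff (fieldProduct k (shiftField m (Y a)) (Y b)) n c := by
  obtain ⟨N, hN⟩ := hloc a b
  have hbig : ∀ (K : ℕ), N ≤ K → ∀ m n, borcherdsLeft Y a b c K m n =
      ncoeff (fieldProduct K (shiftField m (Y a)) (Y b)) n c := by
    intro K hK m n
    have hz : ∀ (K : ℕ) m n, N ≤ K →
        ncoeff (fieldProduct K (shiftField m (Y a)) (Y b)) n = 0 := by
      intro K m n hK
      rw [fieldProduct_nat_mode, diffOp_ge hN hK]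
      rfl
    rw [hz K m n hK, LinearMap.zero_apply, borcherdsLeft]
    convert finsum_zero with j
    have : ncoeff (Y (ncoeff (Y a) (K + j) b)) (m + n - j) = 0 := by
      rw [hit]
      have := hz (K + j) 0 (m + n - j) (by omega)
      rwa [shiftField_zero, Nat.cast_add] at this
    rw [this, LinearMap.zero_apply, smul_zero]
  have hstep : ∀ k, (∀ m n, borcherdsLeft Y a b c (k + 1) m n =
      ncoeff (fieldProduct (k + 1) (shiftField m (Y a)) (Y b)) n c) → ∀ m n,
      borcherdsLeft Y a b c k m n = ncoeff (fieldProduct k (shiftField m (Y a)) (Y b)) n c := by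
    intro k hk m
    have hrec : ∀ m n, borcherdsLeft Y a b c k (m + 1) n -
        ncoeff (fieldProduct k (shiftField (m + 1) (Y a)) (Y b)) n c =
        borcherdsLeft Y a b c k m (n + 1) -
        ncoeff (fieldProduct k (shiftField m (Y a)) (Y b)) (n + 1) c := by
      intro m n
      have h1 := hk m n
      rw [fieldProduct_succ, shiftField_shiftField, map_sub, Pi.sub_apply, LinearMap.sub_apply,
        ncoeff_shiftField] at h1
      rw [borcherdsLeft_succ, h1]
      abel
    induction m with
    | zero =>
      intro n
      obtain ⟨L, hL⟩ := modes_trunc_nat (Y a) k b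
      rw [borcherdsLeft_eq Y a b c k 0 n (L := L + 1) (fun i hi => hL i (by omega)),
        Finset.sum_range_succ', Finset.sum_eq_zero (fun j _ => by
          rw [Ring.choose_zero_succ, zero_smul]), shiftField_zero, ← hit]
      simp
    | succ m ih =>
      intro n
      rw [← sub_eq_zero, hrec, ih, sub_self]
    | pred m ih =>
      intro n
      have := hrec (-m - 1) (n - 1)
      rw [sub_add_cancel, sub_add_cancel, ih, sub_self] at this
      exact sub_eq_zero.1 this.symm
  have hall : ∀ d : ℕ, ∀ m n, borcherdsLeft Y a b c (N - d) m n =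
      ncoeff (fieldProduct (N - d) (shiftField m (Y a)) (Y b)) n c := by
    intro d
    induction d with
    | zero => simpa using hbig N le_rfl
    | succ d ih =>
      apply hstep
      rwa [show (N : ℤ) - (d + 1 : ℕ) + 1 = N - d by push_cast; ring]
  rcases le_total (N : ℤ) k with h | h
  · obtain ⟨K, rfl⟩ := Int.eq_ofNat_of_zero_le (show 0 ≤ k by omega)
    exact hbig K (by omega) m n
  · have := hall ((N : ℤ) - k).toNat m n
    rwa [show (N : ℤ) - ((N : ℤ) - k).toNat = k by omega] at this

end Reconstruction

section Vacuum

variable {𝔤 : Type*} [LieRing 𝔤] [LieAlgebra ℂ 𝔤] (κ : InvariantForm 𝔤) (k : ℂ)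

lemma vacuumMode_trunc (v : VacuumModule κ k) :
    ∀ a : 𝔤, ∃ L : ℤ, ∀ n ≥ L, vacuumMode κ k n a v = 0 := by
  induction v using vacuum_induction with
  | hvac => exact fun a => ⟨0, fun n hn => vacuumMode_vacuum hn a⟩
  | hadd x y hx hy =>
    intro a
    obtain ⟨L, hL⟩ := hx a
    obtain ⟨L', hL'⟩ := hy a
    refine ⟨max L L', fun n hn => ?_⟩
    rw [map_add, hL n (le_trans (le_max_left _ _) hn), hL' n (le_trans (le_max_right _ _) hn),
      add_zero]
  | hsmul c x hx =>
    intro a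
    obtain ⟨L, hL⟩ := hx a
    exact ⟨L, fun n hn => by rw [map_smul, hL n hn, smul_zero]⟩
  | hmode m b x hx =>
    intro a
    obtain ⟨L, hL⟩ := hx a
    obtain ⟨L', hL'⟩ := hx ⁅a, b⁆
    refine ⟨max L (max (L' - m) (1 - m)), fun n hn => ?_⟩
    have h1 : L ≤ n := le_trans (le_max_left _ _) hn
    have h2 : L' - m ≤ n := le_trans (le_max_left _ _) (le_trans (le_max_right _ _) hn)
    have h3 : 1 - m ≤ n := le_trans (le_max_right _ _) (le_trans (le_max_right _ _) hn)
    have h := congrArg (fun f : Module.End ℂ (VacuumModule κ k) => f x)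
      (vacuumMode_level (κ := κ) (k := k) n m a b)
    simp only [LinearMap.sub_apply, Module.End.mul_apply, LinearMap.add_apply,
      LinearMap.smul_apply] at h
    rw [hL n h1, map_zero, sub_zero, hL' (n + m) (by omega), if_neg (by omega), zero_smul,
      add_zero] at h
    exact h

/-- The current `a(z) = ∑ₙ (a ⊗ t^n) z^{-n-1}` acting on the vacuum module. -/
def currentField : 𝔤 →ₗ[ℂ] VertexOperator ℂ (VacuumModule κ k) where
  toFun a := ofModes (fun n => vacuumMode κ k n a) (fun v => vacuumMode_trunc κ k v a)
  map_add' a b := by apply modes_ext; intro n v; simp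
  map_smul' c a := by apply modes_ext; intro n v; simp

@[simp] lemma ncoeff_currentField (a : 𝔤) (n : ℤ) :
    ncoeff (currentField κ k a) n = vacuumMode κ k n a := ncoeff_ofModes _ _ _

/-- The `n`-th products with currents, as operators on the space of fields. -/
def fieldMode (n : ℤ) : 𝔤 →ₗ[ℂ] Module.End ℂ (VertexOperator ℂ (VacuumModule κ k)) where
  toFun a :=
    { toFun := fieldProduct n (currentField κ k a)
      map_add' F G := by simpa using fieldProduct_lin n (currentField κ k a) F G 1
      map_smul' c F := by
        have h0 := fieldProduct_lin n (currentField κ k a) 0 0 1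
        have := fieldProduct_lin n (currentField κ k a) F 0 c
        simp only [one_smul, add_zero, left_eq_add] at h0
        simpa [h0] using this }
  map_add' a b := by
    refine LinearMap.ext fun F => ?_
    simpa using fieldProduct_lin' n (currentField κ k a) (currentField κ k b) F 1
  map_smul' c a := by
    refine LinearMap.ext fun F => ?_
    have h0 := fieldProduct_lin' n 0 0 F 1
    have := fieldProduct_lin' n (currentField κ k a) 0 F c
    simp only [one_smul, add_zero, left_eq_add] at h0
    simpa [h0] using this

lemma fieldMode_apply (n : ℤ) (a : 𝔤) (F : VertexOperator ℂ (VacuumModule κ k)) :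
    fieldMode κ k n a F = fieldProduct n (currentField κ k a) F := rfl

lemma fieldMode_level : IsLevelAction κ k (fieldMode κ k) := by
  intro m n a b
  refine LinearMap.ext fun F => ?_
  have := fieldProduct_commutator (currentField κ k a) (currentField κ k b)
    (currentField κ k ⁅a, b⁆) (κ.form a b * k) (fun x y v => by
      have h := congrArg (fun f : Module.End ℂ (VacuumModule κ k) => f v)
        (vacuumMode_level (κ := κ) (k := k) x y a b)
      simp only [LinearMap.sub_apply, Module.End.mul_apply, LinearMap.add_apply,
        LinearMap.smul_apply, Module.End.one_apply] at h
      rw [ncoeff_currentField, ncoeff_currentField, ncoeff_currentField, ← mul_assoc]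
      exact h) m n F
  rw [← mul_assoc] at this
  exact this

/-- The identity field. -/
def identityField (V : Type*) [AddCommGroup V] [Module ℂ V] : VertexOperator ℂ V :=
  ofModes (fun n => if n = -1 then 1 else 0) (fun v => ⟨0, fun n hn => by
    rw [if_neg (by omega), LinearMap.zero_apply]⟩)

@[simp] lemma ncoeff_identityField {V : Type*} [AddCommGroup V] [Module ℂ V] (n : ℤ) :
    ncoeff (identityField V) n = if n = -1 then 1 else 0 := ncoeff_ofModes _ _ _

lemma modeComm_identityField {V : Type*} [AddCommGroup V] [Module ℂ V] (A : VertexOperator ℂ V) :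
    modeComm A (identityField V) = 0 := by
  funext x y
  simp only [modeComm, ncoeff_identityField]
  split_ifs <;> simp

lemma fieldProduct_identityField {V : Type*} [AddCommGroup V] [Module ℂ V]
    (A : VertexOperator ℂ V) {n : ℤ} (hn : 0 ≤ n) : fieldProduct n A (identityField V) = 0 := by
  obtain ⟨n, rfl⟩ := Int.eq_ofNat_of_zero_le hn
  apply modes_ext
  intro p v
  have := fieldProduct_nat_mode n A (identityField V) 0 p
  rw [shiftField_zero, modeComm_identityField, diffOp_zero] at this
  rw [this]
  simp

/-- The state-field correspondence of the vacuum module: the unique linear map with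
`Y(1, z) = id` and `Y((a ⊗ t^n) v, z) = a(z)_(n) Y(v, z)`. -/
def stateField : VacuumModule κ k →ₗ[ℂ] VertexOperator ℂ (VacuumModule κ k) :=
  vacuumLift (fieldMode κ k) (fieldMode_level κ k) (identityField _)
    (fun _ hn a => fieldProduct_identityField (currentField κ k a) hn)

lemma stateField_vacuum : stateField κ k (vacuum κ k) = identityField _ :=
  vacuumLift_vacuum _ _ _ _

lemma stateField_mode (n : ℤ) (a : 𝔤) (v : VacuumModule κ k) :
    stateField κ k (vacuumMode κ k n a v) = fieldProduct n (currentField κ k a) (stateField κ k v) :=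
  vacuumLift_mode _ _ _ _ n a v

lemma fieldProduct_current_vacuum (m : ℤ) (a : 𝔤) (F : VertexOperator ℂ (VacuumModule κ k)) (n : ℤ)
    {L : ℕ} (hL : ∀ i ≥ L, ncoeff F (n + (i : ℕ)) (vacuum κ k) = 0) :
    ncoeff (fieldProduct m (currentField κ k a) F) n (vacuum κ k) = ∑ i ∈ Finset.range L,
      ((-1 : ℤ) ^ i * Ring.choose m i) •
        vacuumMode κ k (m - i) a (ncoeff F (n + i) (vacuum κ k)) := by
  rw [fieldProduct_mode m _ F n _ hL (fun i _ => by
    rw [ncoeff_currentField, vacuumMode_vacuum (by omega)])]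
  simp [vacuumMode_vacuum]

lemma stateField_creation (v : VacuumModule κ k) :
    ncoeff (stateField κ k v) (-1) (vacuum κ k) = v ∧
      ∀ n : ℤ, 0 ≤ n → ncoeff (stateField κ k v) n (vacuum κ k) = 0 := by
  induction v using vacuum_induction with
  | hvac =>
    rw [stateField_vacuum]
    refine ⟨by simp, fun n hn => ?_⟩
    rw [ncoeff_identityField, if_neg (by omega), LinearMap.zero_apply]
  | hadd x y hx hy =>
    refine ⟨by simp [hx.1, hy.1], fun n hn => by simp [hx.2 n hn, hy.2 n hn]⟩
  | hsmul c x hx =>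
    refine ⟨by simp [hx.1], fun n hn => by simp [hx.2 n hn]⟩
  | hmode m a x hx =>
    rw [stateField_mode]
    refine ⟨?_, fun n hn => ?_⟩
    · rw [fieldProduct_current_vacuum κ k m a _ _ (L := 1) (fun i hi => hx.2 _ (by omega))]
      simp [hx.1]
    · rw [fieldProduct_current_vacuum κ k m a _ _ (L := 0) (fun i hi => hx.2 _ (by omega))]
      simp

/-- The translation operator. -/
def translation : Module.End ℂ (VacuumModule κ k) where
  toFun v := ncoeff (stateField κ k v) (-2) (vacuum κ k)
  map_add' := by simp
  map_smul' := by simp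

lemma translation_apply (v : VacuumModule κ k) :
    translation κ k v = ncoeff (stateField κ k v) (-2) (vacuum κ k) := rfl

lemma translation_vacuum : translation κ k (vacuum κ k) = 0 := by
  rw [translation_apply, stateField_vacuum]
  simp

lemma transCov_current (a : 𝔤) : TransCov (translation κ k) (currentField κ k a) := by
  intro n v
  rw [ncoeff_currentField, ncoeff_currentField, translation_apply, stateField_mode,
    fieldProduct_current_vacuum κ k n a _ _ (L := 2)
      (fun i hi => (stateField_creation κ k v).2 _ (by omega)), Finset.sum_range_succ,
    Finset.sum_range_one]
  simp [(stateField_creation κ k v).1, translation_apply, sub_eq_add_neg]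

lemma transCov_stateField (v : VacuumModule κ k) :
    TransCov (translation κ k) (stateField κ k v) := by
  induction v using vacuum_induction with
  | hvac =>
    rw [stateField_vacuum]
    intro n v
    simp only [ncoeff_identityField]
    by_cases h1 : n = -1
    · subst h1; simp
    · by_cases h0 : n = 0
      · subst h0; simp
      · rw [if_neg h1, if_neg (by omega)]; simp
  | hadd x y hx hy =>
    intro n v
    simp only [map_add, Pi.add_apply, LinearMap.add_apply, hx n v, hy n v, smul_add]
    abel
  | hsmul c x hx =>
    intro n v
    simp only [map_smul, Pi.smul_apply, LinearMap.smul_apply, hx n v, smul_sub, smul_comm c n]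
  | hmode m a x hx =>
    rw [stateField_mode]
    exact (transCov_current κ k a).fieldProduct m hx

lemma isLocal_current (a b : 𝔤) : IsLocal (currentField κ k a) (currentField κ k b) := by
  refine ⟨2, ?_⟩
  have e : modeComm (currentField κ k a) (currentField κ k b) = fun x y =>
      vacuumMode κ k (x + y) ⁅a, b⁆ +
        (if x + y = 0 then (x : ℂ) * κ.form a b * k else 0) • 1 := by
    funext x y
    simp only [modeComm, ncoeff_currentField]
    exact vacuumMode_level x y a b
  rw [e]
  funext x y
  simp only [Function.iterate_succ, Function.iterate_zero, Function.comp_apply, id, diffOp]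
  rw [show x + 1 + 1 + y = x + y + 2 by ring, show x + 1 + (y + 1) = x + y + 2 by ring,
    show x + (y + 1 + 1) = x + y + 2 by ring]
  by_cases h : x + y + 2 = 0
  · simp only [if_pos h]
    push_cast
    simp only [Pi.zero_apply]
    module
  · simp only [if_neg h]
    simp

lemma isLocal_current_stateField (v : VacuumModule κ k) :
    ∀ b : 𝔤, IsLocal (stateField κ k v) (currentField κ k b) := by
  induction v using vacuum_induction with
  | hvac =>
    rw [stateField_vacuum]
    exact fun b => IsLocal.symm ⟨0, modeComm_identityField _⟩
  | hadd x y hx hy => rw [map_add]; exact fun b => (hx b).add (hy b)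
  | hsmul c x hx => rw [map_smul]; exact fun b => (hx b).smul c
  | hmode m a x hx =>
    rw [stateField_mode]
    exact fun b => IsLocal.fieldProduct m (hx a).symm (isLocal_current κ k a b) (hx b)

lemma isLocal_stateField (v w : VacuumModule κ k) :
    IsLocal (stateField κ k v) (stateField κ k w) := by
  induction v using vacuum_induction with
  | hvac =>
    rw [stateField_vacuum]
    exact IsLocal.symm ⟨0, modeComm_identityField _⟩
  | hadd x y hx hy => rw [map_add]; exact hx.add hy
  | hsmul c x hx => rw [map_smul]; exact hx.smul c
  | hmode m a x hx =>
    rw [stateField_mode]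
    exact IsLocal.fieldProduct m (isLocal_current_stateField κ k x a).symm
      (isLocal_current_stateField κ k w a).symm hx

/-- The formula for the fields of the products of states. -/
lemma stateField_product (u v : VacuumModule κ k) (m : ℤ) :
    stateField κ k (ncoeff (stateField κ k u) m v) =
      fieldProduct m (stateField κ k u) (stateField κ k v) := by
  rw [← sub_eq_zero]
  set F := stateField κ k (ncoeff (stateField κ k u) m v) -
      fieldProduct m (stateField κ k u) (stateField κ k v) with hF
  have hcr : ∀ (w : VacuumModule κ k) (n : ℤ), 0 ≤ n →
      ncoeff (stateField κ k w) n (vacuum κ k) = 0 := fun w => (stateField_creation κ k w).2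
  have hfp : ∀ n : ℤ, -1 ≤ n →
      ncoeff (fieldProduct m (stateField κ k u) (stateField κ k v)) n (vacuum κ k) =
      ncoeff (stateField κ k u) m (ncoeff (stateField κ k v) n (vacuum κ k)) := by
    intro n hn
    rw [fieldProduct_mode m _ _ n _ (L := 1) (fun i hi => hcr _ _ (by omega))
      (fun i _ => hcr _ _ (by omega)), Finset.sum_range_one, Finset.sum_range_one]
    rw [hcr u _ (by simp)]
    simp
  have h1 : ∀ n : ℤ, -1 ≤ n → ncoeff F n (vacuum κ k) = 0 := by
    intro n hn
    rw [hF, map_sub, Pi.sub_apply, LinearMap.sub_apply, hfp n hn, sub_eq_zero]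
    rcases eq_or_lt_of_le hn with rfl | hn
    · rw [(stateField_creation κ k v).1, (stateField_creation κ k _).1]
    · rw [hcr _ n (by omega), hcr v n (by omega), map_zero]
  have hT : TransCov (translation κ k) F := by
    intro n w
    have e1 := transCov_stateField κ k (ncoeff (stateField κ k u) m v) n w
    have e2 := (transCov_stateField κ k u).fieldProduct m (transCov_stateField κ k v) n w
    simp only [hF, map_sub, Pi.sub_apply, LinearMap.sub_apply, e1, e2, smul_sub]
    abel
  have h2 : ∀ d : ℕ, ncoeff F (-1 - d) (vacuum κ k) = 0 := by
    intro d
    induction d with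
    | zero => exact h1 _ (by simp)
    | succ d ih =>
      have := hT (-1 - d) (vacuum κ k)
      rw [ih, translation_vacuum, map_zero, map_zero, zero_sub, eq_comm, neg_eq_zero,
        ← Int.cast_smul_eq_zsmul ℂ, smul_eq_zero] at this
      rw [Nat.cast_succ, ← sub_sub]
      refine this.resolve_left ?_
      have : (-1 - d : ℤ) ≠ 0 := by omega
      exact_mod_cast this
  refine eq_of_local_of_vacuum (vac := vacuum κ k) (Y := stateField κ k)
    (fun w => (stateField_creation κ k w).1) (fun w n => hcr w n (by simp)) (fun n => ?_)
    (fun w => ?_)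
  · rcases le_total (-1) n with h | h
    · exact h1 n h
    · have := h2 (-1 - n).toNat
      rwa [show (-1 : ℤ) - ((-1 - n).toNat : ℤ) = n by omega] at this
  · have e : F = stateField κ k (ncoeff (stateField κ k u) m v) +
        (-1 : ℂ) • fieldProduct m (stateField κ k u) (stateField κ k v) := by
      rw [hF]
      apply modes_ext
      intro n v
      simp [sub_eq_add_neg]
    rw [e]
    exact (isLocal_stateField κ k _ _).add ((IsLocal.fieldProduct m (isLocal_stateField κ k u v)
      (isLocal_stateField κ k u w) (isLocal_stateField κ k v w)).smul _)

/-- The universal affine vertex algebra `V_k(𝔤)` of level `k`. -/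
def universalAffine : VertexAlgebra (VacuumModule κ k) where
  vacuum := vacuum κ k
  Y := stateField κ k
  vacuum_mode n := by rw [stateField_vacuum, ncoeff_identityField]
  mode_vacuum v := (stateField_creation κ k v).1
  mode_vacuum_of_nonneg v n hn := (stateField_creation κ k v).2 n hn
  borcherds a b c p m n := by
    rw [← fieldProduct_shift_mode]
    exact borcherds_of_local (stateField κ k) (fun a b p => stateField_product κ k a b p)
      (isLocal_stateField κ k) a b c p m n

end Vacuum

/-! ## Automorphisms, twisted modules, twisted affine algebras -/

section Invariance

variable {𝔤 : Type*} [LieRing 𝔤] [LieAlgebra ℂ 𝔤] [FiniteDimensional ℂ 𝔤] [LieAlgebra.IsSimple ℂ 𝔤]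

/-- On a simple Lie algebra an invariant form is a multiple of the Killing form. -/
lemma InvariantForm.eq_smul_killing (κ : InvariantForm 𝔤) :
    ∃ c : ℂ, ∀ a b, κ.form a b = c * killingForm ℂ 𝔤 a b := by
  have hK := LieAlgebra.IsKilling.killingForm_nondegenerate ℂ 𝔤
  have : Nontrivial 𝔤 := by
    by_contra h
    rw [not_nontrivial_iff_subsingleton] at h
    exact LieAlgebra.IsSimple.non_abelian ℂ (L := 𝔤) ⟨fun _ _ => Subsingleton.elim _ _⟩
  let T : Module.End ℂ 𝔤 :=
    ((killingForm ℂ 𝔤).toDual hK).symm.toLinearMap ∘ₗ κ.form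
  have hT : ∀ a b, killingForm ℂ 𝔤 (T a) b = κ.form a b := fun a b =>
    LinearMap.BilinForm.apply_toDual_symm_apply (hB := hK) (κ.form a) b
  have hinv : ∀ x a b, killingForm ℂ 𝔤 ⁅x, a⁆ b = - killingForm ℂ 𝔤 a ⁅x, b⁆ := fun x a b => by
    rw [← lie_skew, map_neg, LinearMap.neg_apply]
    exact congrArg _ (LieModule.traceForm_apply_lie_apply ℂ 𝔤 𝔤 a x b)
  have hTlie : ∀ x a, T ⁅x, a⁆ = ⁅x, T a⁆ := fun x a => by
    rw [← sub_eq_zero]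
    refine hK.1 _ fun b => ?_
    rw [map_sub, LinearMap.sub_apply, hT, hinv, hT, κ.invariant x a b, sub_self]
  obtain ⟨c, hc⟩ := Module.End.exists_eigenvalue T
  let I : LieIdeal ℂ 𝔤 :=
    { Module.End.eigenspace T c with
      lie_mem := by
        intro x m hm
        change m ∈ Module.End.eigenspace T c at hm
        change _ ∈ Module.End.eigenspace T c
        rw [Module.End.mem_eigenspace_iff] at hm ⊢
        rw [hTlie, hm, lie_smul] }
  have hI : I = ⊤ := (LieAlgebra.IsSimple.eq_bot_or_eq_top I).resolve_left fun h => by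
    obtain ⟨v, hv, hv0⟩ := hc.exists_hasEigenvector
    exact hv0 ((LieSubmodule.eq_bot_iff I).1 h v hv)
  refine ⟨c, fun a b => ?_⟩
  have ha : a ∈ I := hI ▸ LieSubmodule.mem_top a
  change a ∈ Module.End.eigenspace T c at ha
  rw [Module.End.mem_eigenspace_iff] at ha
  rw [← hT, ha, map_smul, LinearMap.smul_apply, smul_eq_mul]

lemma InvariantForm.map_apply (κ : InvariantForm 𝔤) (σ : 𝔤 ≃ₗ⁅ℂ⁆ 𝔤) (a b : 𝔤) :
    κ.form (σ a) (σ b) = κ.form a b := by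
  obtain ⟨c, hc⟩ := κ.eq_smul_killing
  rw [hc, hc, LieAlgebra.killingForm_of_equiv_apply]

end Invariance

section Automorphism

/-- An automorphism of a vertex algebra: a linear bijection that fixes the vacuum and preserves all
products `a_(n) b`. -/
structure VertexAlgebra.Automorphism {V : Type*} [AddCommGroup V] [Module ℂ V]
    (𝒱 : VertexAlgebra V) extends V ≃ₗ[ℂ] V where
  map_vacuum : toLinearEquiv 𝒱.vacuum = 𝒱.vacuum
  map_mode : ∀ (a b : V) (n : ℤ), toLinearEquiv (ncoeff (𝒱.Y a) n b) =
    ncoeff (𝒱.Y (toLinearEquiv a)) n (toLinearEquiv b)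

variable {𝔤 : Type*} [LieRing 𝔤] [LieAlgebra ℂ 𝔤] [FiniteDimensional ℂ 𝔤] [LieAlgebra.IsSimple ℂ 𝔤]
  (κ : InvariantForm 𝔤) (k : ℂ) (σ : 𝔤 ≃ₗ⁅ℂ⁆ 𝔤)

/-- The linear map `V_k(𝔤) → V_k(𝔤)` with `1 ↦ 1` and `(a ⊗ t^n) v ↦ (σ a ⊗ t^n) σ(v)`. -/
def affineMap : VacuumModule κ k →ₗ[ℂ] VacuumModule κ k :=
  vacuumLift (fun n => vacuumMode κ k n ∘ₗ (σ : 𝔤 →ₗ[ℂ] 𝔤))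
    (fun m n a b => by
      have := vacuumMode_level (κ := κ) (k := k) m n (σ a) (σ b)
      rw [κ.map_apply, ← LieEquiv.map_lie] at this
      exact this)
    (vacuum κ k) (fun _ hn a => vacuumMode_vacuum hn (σ a))

lemma affineMap_vacuum : affineMap κ k σ (vacuum κ k) = vacuum κ k := vacuumLift_vacuum _ _ _ _

lemma affineMap_vacuumMode (n : ℤ) (a : 𝔤) (v : VacuumModule κ k) :
    affineMap κ k σ (vacuumMode κ k n a v) = vacuumMode κ k n (σ a) (affineMap κ k σ v) :=
  vacuumLift_mode _ _ _ _ n a v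

lemma affineMap_comp (τ : 𝔤 ≃ₗ⁅ℂ⁆ 𝔤) (h : ∀ a, σ (τ a) = a) (v : VacuumModule κ k) :
    affineMap κ k σ (affineMap κ k τ v) = v := by
  induction v using vacuum_induction with
  | hvac => rw [affineMap_vacuum, affineMap_vacuum]
  | hadd x y hx hy => rw [map_add, map_add, hx, hy]
  | hsmul c x hx => rw [map_smul, map_smul, hx]
  | hmode n a x hx => rw [affineMap_vacuumMode, affineMap_vacuumMode, hx, h]

lemma affineMap_mode (u : VacuumModule κ k) : ∀ (n : ℤ) (v : VacuumModule κ k),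
    affineMap κ k σ (ncoeff (stateField κ k u) n v) =
      ncoeff (stateField κ k (affineMap κ k σ u)) n (affineMap κ k σ v) := by
  induction u using vacuum_induction with
  | hvac =>
    intro n v
    rw [affineMap_vacuum, stateField_vacuum, ncoeff_identityField]
    split_ifs <;> simp
  | hadd x y hx hy => intro n v; simp [hx, hy]
  | hsmul c x hx => intro n v; simp [hx]
  | hmode m a x hx =>
    intro n v
    rw [affineMap_vacuumMode, stateField_mode, stateField_mode]
    obtain ⟨L1, h1⟩ := modes_trunc_nat (stateField κ k x) n v
    obtain ⟨L2, h2⟩ := modes_trunc_nat (currentField κ k a) 0 v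
    simp only [zero_add] at h2
    rw [fieldProduct_mode m _ _ n v (L := L1 + L2) (fun i hi => h1 i (by omega))
      (fun i hi => h2 i (by omega)), fieldProduct_mode m _ _ n _ (L := L1 + L2)
      (fun i hi => by rw [← hx, h1 i (by omega), map_zero])
      (fun i hi => by
        rw [ncoeff_currentField, ← affineMap_vacuumMode, ← ncoeff_currentField, h2 i (by omega),
          map_zero])]
    simp only [map_sub, map_sum, map_zsmul, ncoeff_currentField, affineMap_vacuumMode, hx]

/-- The automorphism of `V_k(𝔤)` induced by an automorphism `σ` of `𝔤`. -/
def affineAut : (universalAffine κ k).Automorphism where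
  toLinearEquiv := LinearEquiv.ofLinearMap (affineMap κ k σ) (affineMap κ k σ.symm)
    (LinearMap.ext (affineMap_comp κ k σ σ.symm σ.apply_symm_apply))
    (LinearMap.ext (affineMap_comp κ k σ.symm σ σ.symm_apply_apply))
  map_vacuum := affineMap_vacuum κ k σ
  map_mode a b n := affineMap_mode κ k σ a n b

end Automorphism

/-- A `σ`-twisted module over a vertex algebra, for an automorphism with `σ^N = 1`. Here `mode a p` is
the mode `a^M_(p/N)`, the coefficient of `z^(-p/N-1)` in `Y^M(a, z)`. The axioms are: truncation,
`Y^M(1, z) = id`, `Y^M(σ a, z) = Y^M(a, e^(2πi) z)`, and the twisted Borcherds identity for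
`a_(m)`, `b_(n)` with `m = p/N`, `n = q/N` and `σ a = e^(-2πi m) a`. -/
structure TwistedModule {V : Type*} [AddCommGroup V] [Module ℂ V] (𝒱 : VertexAlgebra V)
    (σ : 𝒱.Automorphism) (N : ℕ) (M : Type*) [AddCommGroup M] [Module ℂ M] where
  mode : V →ₗ[ℂ] (ℤ → Module.End ℂ M)
  trunc : ∀ a v, ∃ L : ℤ, ∀ p ≥ L, mode a p v = 0
  vacuum : ∀ p, mode 𝒱.vacuum p = if p = -N then 1 else 0
  equivariance : ∀ a (p : ℤ), mode (σ.toLinearEquiv a) p =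
    Complex.exp (-(2 * Real.pi * Complex.I * p / N)) • mode a p
  borcherds : ∀ (a b : V) (c : M) (k p q : ℤ),
    σ.toLinearEquiv a = Complex.exp (-(2 * Real.pi * Complex.I * p / N)) • a →
    ∑ᶠ j : ℕ, Ring.choose ((p : ℂ) / N) j • mode (ncoeff (𝒱.Y a) (k + j) b) (p + q - N * j) c =
      ∑ᶠ i : ℕ, ((-1 : ℤ) ^ i * Ring.choose k i) •
        mode a (p + N * (k - i)) (mode b (q + N * i) c) -
      ∑ᶠ i : ℕ, ((k.negOnePow : ℤ) * (-1 : ℤ) ^ i * Ring.choose k i) •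
        mode b (q + N * (k - i)) (mode a (p + N * i) c)

section Twisted

variable {𝔤 : Type*} [LieRing 𝔤] [LieAlgebra ℂ 𝔤] (κ : InvariantForm 𝔤) (τ : 𝔤 ≃ₗ⁅ℂ⁆ 𝔤) (N : ℕ)

/-- The elements `a ⊗ t^j` with `τ a = e^(2πij/N) a`, and `K`. -/
def twistedGenerators : Set (AffineAlgebra κ) :=
  {x | ∃ (j : ℤ) (a : 𝔤), τ a = Complex.exp (2 * Real.pi * Complex.I * j / N) • a ∧
    x = current κ j a} ∪ {central κ}

lemma twistedGenerators_lie {x y : AffineAlgebra κ} (hx : x ∈ twistedGenerators κ τ N)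
    (hy : y ∈ twistedGenerators κ τ N) : ⁅x, y⁆ ∈ Submodule.span ℂ (twistedGenerators κ τ N) := by
  rcases hx with ⟨i, a, ha, rfl⟩ | rfl
  · rcases hy with ⟨j, b, hb, rfl⟩ | rfl
    · rw [current_lie_current]
      refine Submodule.add_mem _ (Submodule.subset_span (Or.inl ⟨i + j, ⁅a, b⁆, ?_, rfl⟩))
        (Submodule.smul_mem _ _ (Submodule.subset_span (Or.inr rfl)))
      rw [LieEquiv.map_lie, ha, hb, smul_lie, lie_smul, smul_smul, ← Complex.exp_add]
      congr 2
      push_cast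
      ring
    · rw [← lie_skew, central_lie, neg_zero]
      exact Submodule.zero_mem _
  · rw [central_lie]
    exact Submodule.zero_mem _

/-- The twisted affine algebra `⨁ⱼ 𝔤ⱼ ⊗ t^j ⊕ ℂ K ⊆ ĝ`, where `𝔤ⱼ = {a | τ a = e^(2πij/N) a}`. -/
def twistedAffine : LieSubalgebra ℂ (AffineAlgebra κ) where
  toSubmodule := Submodule.span ℂ (twistedGenerators κ τ N)
  lie_mem' := by
    intro x y hx hy
    change x ∈ Submodule.span ℂ (twistedGenerators κ τ N) at hx
    change y ∈ Submodule.span ℂ (twistedGenerators κ τ N) at hy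
    change ⁅x, y⁆ ∈ Submodule.span ℂ (twistedGenerators κ τ N)
    induction hx using Submodule.span_induction with
    | zero => rw [zero_lie]; exact Submodule.zero_mem _
    | add u v _ _ hu hv => rw [add_lie]; exact Submodule.add_mem _ hu hv
    | smul c u _ hu => rw [smul_lie]; exact Submodule.smul_mem _ _ hu
    | mem u hu =>
      induction hy using Submodule.span_induction with
      | zero => rw [lie_zero]; exact Submodule.zero_mem _
      | add v w _ _ hv hw => rw [lie_add]; exact Submodule.add_mem _ hv hw
      | smul c v _ hv => rw [lie_smul]; exact Submodule.smul_mem _ _ hv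
      | mem v hv => exact twistedGenerators_lie κ τ N hu hv

/-- The element `a ⊗ t^j` of the twisted affine algebra, for `τ a = e^(2πij/N) a`. -/
def twistedCurrent (j : ℤ) (a : 𝔤) (ha : τ a = Complex.exp (2 * Real.pi * Complex.I * j / N) • a) :
    twistedAffine κ τ N :=
  ⟨current κ j a, Submodule.subset_span (Or.inl ⟨j, a, ha, rfl⟩)⟩

/-- The element `K` of the twisted affine algebra. -/
def twistedCentral : twistedAffine κ τ N := ⟨central κ, Submodule.subset_span (Or.inr rfl)⟩

/-- The vector `a = a_(-1) 1` of `V_k(𝔤)`. -/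
def currentVector (k : ℂ) (a : 𝔤) : VacuumModule κ k := vacuumMode κ k (-1) a (vacuum κ k)

end Twisted

end AffineVertex

end

open AffineVertex

/-! The theorem is the twisted commutator formula, read on generators. When the first index of the
twisted Borcherds identity is `0`, both sums on the right collapse to their terms with `i = 0`, and
for `σ a = e^(-2πim) a` it becomes `[a_(m), b_(n)] = ∑_j (m choose j) (a_(j) b)_(m+n-j)`. Only the
products `a_(j) b` with `j ≥ 0`, computed in `V_k(𝔤)`, enter. For `a, b ∈ 𝔤` they are `a_(0) b = [a,
b]`, `a_(1) b = k (a|b) 1`, and zero from `j = 2` on (`currentVector_product`). Since the vacuum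
acts by the identity field, the result is `[a_(m), b_(n)] = [a, b]_(m+n) + m δ_{m,-n} (a|b) k`
(`currentMode_lie`).

Put `m = p/N`. The central coefficient is then `p/N`, whereas the bracket of `a ⊗ t^p` in `ĝ` has
coefficient `p`; so `a ⊗ t^p ↦ a_(p/N)` respects brackets exactly when `K ↦ k/N`. The formula asks
that `a` be an eigenvector of `σ` with eigenvalue `e^(-2πip/N)`, which is the condition defining the
twisted affine algebra of `σ⁻¹`. This gives the representation `twistedRep`. It is unique because
the twisted affine algebra is spanned by the elements `a ⊗ t^j` and `K`.

The image has to be compared with the Lie algebra generated by all modes `a_(p/N)`, where `a` need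
not be an eigenvector. Equivariance makes `a_(p/N)` depend only on the component of `a` in the
eigenspace for `e^(-2πip/N)` (`currentMode_eigenProjection`), so each of these modes is the image of
a twisted current. In the other direction, the scalar `k/N` must be recovered from modes
(`level_mem_lieSpan`). Take an eigenvector `a ≠ 0` with exponent `p ≠ 0` and, by nondegeneracy, some
`b` with `(a|b) ≠ 0`. Then `[a_(p/N), b_(-p/N)] - [a, b]_(0)` is a nonzero multiple of `k/N`. An
exponent `p ≠ 0` is always available because `p` matters only modulo `N`. -/

noncomputable section

namespace AffineVertex

open VertexOperator (ncoeff)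

/-! ### Products of the generators of `V_k(𝔤)` -/

section CurrentVector

variable {𝔤 : Type*} [LieRing 𝔤] [LieAlgebra ℂ 𝔤] (κ : InvariantForm 𝔤) (k : ℂ)

/-- The linear map `a ↦ a_(-1) 1`. -/
def currentVectorLinear : 𝔤 →ₗ[ℂ] VacuumModule κ k where
  toFun := currentVector κ k
  map_add' a b := by simp [currentVector]
  map_smul' c a := by simp [currentVector]

lemma choose_neg_one (n : ℕ) : Ring.choose (-1 : ℤ) n = (-1) ^ n := by
  have := Ring.choose_neg (1 : ℤ) n
  rw [show (1 : ℤ) + n - 1 = n by ring, Ring.choose_natCast, Nat.choose_self] at this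
  simpa [Int.negOnePow_def, Units.smul_def] using this

/-- The field of `a_(-1) 1` is the `(-1)`-st product of the current with the identity field, whose
only nonzero mode has index `-1`. Nonnegative modes suffice here, since no others occur in the
commutator formula. -/
lemma stateField_currentVector (a : 𝔤) (n : ℕ) (v : VacuumModule κ k) :
    ncoeff (stateField κ k (currentVector κ k a)) n v = vacuumMode κ k n a v := by
  obtain ⟨L, hL⟩ := modes_trunc_nat (currentField κ k a) 0 v
  simp only [zero_add] at hL
  -- The left half vanishes, as `n + i = -1` is impossible. In the right half `-1 + n - i = -1`
  -- forces `i = n`; the cutoff `max L (n + 1)` keeps this term in range.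
  rw [currentVector, stateField_mode, stateField_vacuum, fieldProduct, map_sub, Pi.sub_apply,
    LinearMap.sub_apply, productLeft_mode (-1) _ _ n v (L := 0) (fun i _ => by
      rw [ncoeff_identityField, if_neg (by omega), LinearMap.zero_apply]),
    productRight_mode (-1) _ _ n v (L := max L (n + 1)) (fun i hi => hL i (by omega)),
    Finset.sum_range_zero, zero_sub, Finset.sum_eq_single n]
  -- The factors `(-1)^n` and `(-1 choose n) = (-1)^n` cancel, and the sign of the right half
  -- cancels `(-1)^(-1)`.
  · simp [choose_neg_one, ← mul_pow]
  · intro i _ hi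
    rw [ncoeff_identityField, if_neg (by omega), LinearMap.zero_apply, smul_zero]
  · intro h
    exact absurd (Finset.mem_range.2 (by omega)) h

/-- The products `a_(n) b` of two generators of `V_k(𝔤)` with `n ≥ 0`. -/
lemma currentVector_product (a b : 𝔤) (n : ℕ) :
    ncoeff (stateField κ k (currentVector κ k a)) n (currentVector κ k b) =
      if n = 0 then currentVector κ k ⁅a, b⁆
      else if n = 1 then (κ.form a b * k) • vacuum κ k else 0 := by
  -- Since `a_(n) 1 = 0` for `n ≥ 0`, the vector `a_(n) b_(-1) 1` equals `[a_(n), b_(-1)] 1`.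
  have h := congrArg (fun f => f (vacuum κ k)) (vacuumMode_level (κ := κ) (k := k) n (-1) a b)
  simp only [LinearMap.sub_apply, Module.End.mul_apply, LinearMap.add_apply, LinearMap.smul_apply,
    Module.End.one_apply, vacuumMode_vacuum (Int.natCast_nonneg n) a, map_zero, sub_zero] at h
  rw [stateField_currentVector, currentVector, h]
  -- The commutator is `[a, b]_(n-1)` plus a central term present only for `n = 1`; the mode `n - 1`
  -- kills the vacuum once `n ≥ 1`.
  rcases n with _ | _ | n
  · simp [currentVector]
  · simp [vacuumMode_vacuum le_rfl]
  · rw [vacuumMode_vacuum (by omega), if_neg (by omega), if_neg (by omega), if_neg (by omega)]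
    simp

end CurrentVector

/-! ### Eigenspaces of `σ` and their projections -/

section Eigenspaces

variable {𝔤 : Type*} [LieRing 𝔤] [LieAlgebra ℂ 𝔤] {κ : InvariantForm 𝔤} {σ : 𝔤 ≃ₗ⁅ℂ⁆ 𝔤} {N : ℕ}

/-- Passes between the two sign conventions: the twisted affine algebra is graded by eigenvalues of
`σ⁻¹`, whereas the axioms of a twisted module refer to eigenvalues of `σ`. -/
lemma symm_eigen_iff {τ : 𝔤 ≃ₗ⁅ℂ⁆ 𝔤} {j : ℤ} {a : 𝔤} :
    τ.symm a = Complex.exp (2 * Real.pi * Complex.I * j / N) • a ↔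
      τ a = Complex.exp (-(2 * Real.pi * Complex.I * j / N)) • a := by
  constructor <;> intro h
  · have h' := congrArg τ h
    rw [LieEquiv.apply_symm_apply, map_smul] at h'
    rw [Complex.exp_neg, eq_inv_smul_iff₀ (Complex.exp_ne_zero _), ← h']
  · have h' := congrArg τ.symm h
    rw [LieEquiv.symm_apply_apply, map_smul, Complex.exp_neg,
      eq_inv_smul_iff₀ (Complex.exp_ne_zero _)] at h'
    exact h'.symm

/-- The projection `N⁻¹ ∑ᵢ e^(2πipi/N) σ^i` onto the eigenspace of `σ` for `e^(-2πip/N)`. -/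
def eigenProjection (σ : 𝔤 ≃ₗ⁅ℂ⁆ 𝔤) (N : ℕ) (p : ℤ) (a : 𝔤) : 𝔤 :=
  (N : ℂ)⁻¹ • ∑ i ∈ Finset.range N,
    Complex.exp (2 * Real.pi * Complex.I * p / N) ^ i • σ^[i] a

lemma exp_pow_order (hN : 0 < N) (p : ℤ) :
    Complex.exp (2 * Real.pi * Complex.I * p / N) ^ N = 1 := by
  have : (N : ℂ) ≠ 0 := by exact_mod_cast hN.ne'
  rw [← Complex.exp_nat_mul, ← Complex.exp_int_mul_two_pi_mul_I p]
  congr 1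
  field_simp

/-- With `ζ = e^(2πip/N)`, the operator `ζσ` has `N`-th power `1`, so it permutes the summands
`(ζσ)^i a` cyclically and fixes their average. -/
lemma map_eigenProjection (hN : 0 < N) (hσ : ∀ a, σ^[N] a = a) (p : ℤ) (a : 𝔤) :
    σ (eigenProjection σ N p a) =
      Complex.exp (-(2 * Real.pi * Complex.I * p / N)) • eigenProjection σ N p a := by
  rw [Complex.exp_neg, eq_inv_smul_iff₀ (Complex.exp_ne_zero _), eigenProjection, map_smul,
    smul_comm, map_sum, Finset.smul_sum]
  congr 1
  -- The sum over `i ≤ N` is split off at both ends. The terms `i = 0` and `i = N` are both `a`, so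
  -- the sums over `0 ≤ i < N` and over `1 ≤ i ≤ N` agree.
  have h := Finset.sum_range_succ
    (fun i => Complex.exp (2 * Real.pi * Complex.I * p / N) ^ i • σ^[i] a) N
  rw [Finset.sum_range_succ', exp_pow_order hN, hσ, pow_zero, Function.iterate_zero, id,
    add_left_inj] at h
  rw [← h]
  refine Finset.sum_congr rfl fun i _ => ?_
  rw [map_smul, smul_smul, pow_succ', Function.iterate_succ_apply']

/-- The twisted affine algebra is spanned by the elements `a ⊗ t^j` and `K`. -/
lemma twistedAffine_induction {τ : 𝔤 ≃ₗ⁅ℂ⁆ 𝔤} {P : twistedAffine κ τ N → Prop} (h0 : P 0)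
    (hadd : ∀ x y, P x → P y → P (x + y)) (hsmul : ∀ (c : ℂ) x, P x → P (c • x))
    (hcur : ∀ j a ha, P (twistedCurrent κ τ N j a ha)) (hcen : P (twistedCentral κ τ N)) (x) :
    P x := by
  obtain ⟨x, hx⟩ := x
  have hx' : x ∈ Submodule.span ℂ (twistedGenerators κ τ N) := hx
  -- Span induction runs over elements of `ĝ`, but `P` needs a bundled element of the subalgebra;
  -- the membership proof is therefore carried along with `P`.
  suffices ∃ h : x ∈ twistedAffine κ τ N, P ⟨x, h⟩ from this.2
  induction hx' using Submodule.span_induction with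
  | zero => exact ⟨_, h0⟩
  | add u v hu hv ihu ihv => exact ⟨_, hadd _ _ (ihu hu).2 (ihv hv).2⟩
  | smul c u hu ihu => exact ⟨_, hsmul c _ (ihu hu).2⟩
  | mem u hu =>
    rcases hu with ⟨j, a, ha, rfl⟩ | rfl
    · exact ⟨_, hcur j a ha⟩
    · exact ⟨_, hcen⟩

end Eigenspaces

lemma nontrivial_of_isSimple (𝔤 : Type*) [LieRing 𝔤] [LieAlgebra ℂ 𝔤] [LieAlgebra.IsSimple ℂ 𝔤] :
    Nontrivial 𝔤 := by
  by_contra h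
  rw [not_nontrivial_iff_subsingleton] at h
  exact LieAlgebra.IsSimple.non_abelian ℂ (L := 𝔤) ⟨fun _ _ => Subsingleton.elim _ _⟩

/-! ### Modes of currents on a twisted module and their commutators -/

section TwistedCurrents

variable {𝔤 : Type*} [LieRing 𝔤] [LieAlgebra ℂ 𝔤] [FiniteDimensional ℂ 𝔤]
  [LieAlgebra.IsSimple ℂ 𝔤] {κ : InvariantForm 𝔤} {k : ℂ} {σ : 𝔤 ≃ₗ⁅ℂ⁆ 𝔤} {N : ℕ}

lemma affineAut_currentVector (a : 𝔤) :
    (affineAut κ k σ).toLinearEquiv (currentVector κ k a) = currentVector κ k (σ a) := by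
  change affineMap κ k σ (vacuumMode κ k (-1) a (vacuum κ k)) = _
  rw [affineMap_vacuumMode, affineMap_vacuum, currentVector]

variable {M : Type*} [AddCommGroup M] [Module ℂ M]
  (Y : TwistedModule (universalAffine κ k) (affineAut κ k σ) N M)

/-- The operators `a^M_(p/N)` for `a ∈ 𝔤`, as linear maps in `a`. -/
def currentMode (p : ℤ) : 𝔤 →ₗ[ℂ] Module.End ℂ M :=
  LinearMap.proj p ∘ₗ Y.mode ∘ₗ currentVectorLinear κ k

lemma currentMode_apply (p : ℤ) (a : 𝔤) :
    currentMode Y p a = Y.mode (currentVector κ k a) p := rfl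

/-- The automorphism of `V_k(𝔤)` restricts to `σ` on `𝔤`, so equivariance of the module becomes a
condition on the modes of currents. -/
lemma currentMode_map (p : ℤ) (a : 𝔤) : currentMode Y p (σ a) =
    Complex.exp (-(2 * Real.pi * Complex.I * p / N)) • currentMode Y p a := by
  rw [currentMode_apply, ← affineAut_currentVector, Y.equivariance, currentMode_apply]

/-- The commutator formula for the modes of the fields `Y^M(a, z)`. -/
lemma currentMode_lie {p : ℤ} {a : 𝔤}
    (ha : σ a = Complex.exp (-(2 * Real.pi * Complex.I * p / N)) • a) (q : ℤ) (b : 𝔤) :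
    ⁅currentMode Y p a, currentMode Y q b⁆ = currentMode Y (p + q) ⁅a, b⁆ +
      (if p + q = 0 then (p / N : ℂ) * (κ.form a b * k) else 0) • (1 : Module.End ℂ M) := by
  ext c
  -- With first index `0` the Borcherds identity is the commutator formula. It requires only `a` to
  -- be an eigenvector; `b` is arbitrary.
  have h := Y.borcherds (currentVector κ k a) (currentVector κ k b) c 0 p q (by
    rw [affineAut_currentVector, ha, currentVector, map_smul, LinearMap.smul_apply, currentVector])
  have e : (universalAffine κ k).Y = stateField κ k := rfl
  have e' : vacuum κ k = (universalAffine κ k).vacuum := rfl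
  -- On the left only `j = 0, 1` survive, since `a_(j) b = 0` for `j ≥ 2`. On the right `(0 choose
  -- i) = 0` for `i > 0`, which leaves the two orderings of the product.
  rw [finsum_eq_range (L := 2) (fun i hi => by
      rw [zero_add, e, currentVector_product, if_neg (by omega), if_neg (by omega)]; simp),
    finsum_eq_range (L := 1) (fun i hi => by simp [Ring.choose_zero_pos ℤ (show 0 < i by omega)]),
    finsum_eq_range (L := 1) (fun i hi => by simp [Ring.choose_zero_pos ℤ (show 0 < i by omega)])]
    at h
  rw [Finset.sum_range_succ, Finset.sum_range_one, zero_add, zero_add, e, currentVector_product,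
    currentVector_product, e'] at h
  rw [LieRing.of_associative_ring_bracket]
  simp only [LinearMap.sub_apply, Module.End.mul_apply, LinearMap.add_apply, LinearMap.smul_apply,
    Module.End.one_apply, currentMode_apply]
  -- The term `j = 1` is `(p/N) (a|b) k` times the mode of the vacuum at index `p + q - N`. That
  -- mode is the identity when the index is `-N`, that is, when `p + q = 0`, and zero otherwise.
  simp [Y.vacuum] at h
  rw [← h]
  congr 1
  by_cases hpq : p + q = 0
  · simp [hpq, smul_smul]
  · rw [if_neg hpq, if_neg (by omega)]
    simp

/-- By equivariance each summand `e^(2πipi/N) σ^i a` has the same mode at `p` as `a`, hence so does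
their average. Thus every mode of a current is already the mode of a suitable eigenvector. -/
lemma currentMode_eigenProjection (hN : 0 < N) (p : ℤ) (a : 𝔤) :
    currentMode Y p (eigenProjection σ N p a) = currentMode Y p a := by
  have h : ∀ i : ℕ, Complex.exp (2 * Real.pi * Complex.I * p / N) ^ i •
      currentMode Y p (σ^[i] a) = currentMode Y p a := by
    intro i
    induction i with
    | zero => simp
    | succ i ih =>
      rw [Function.iterate_succ_apply', currentMode_map, pow_succ, mul_smul, smul_smul _ _
        (currentMode Y p _), ← Complex.exp_add, add_neg_cancel, Complex.exp_zero, one_smul, ih]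
  rw [eigenProjection, map_smul, map_sum]
  simp_rw [map_smul, h]
  rw [Finset.sum_const, Finset.card_range, ← Nat.cast_smul_eq_nsmul ℂ,
    inv_smul_smul₀ (by exact_mod_cast hN.ne')]

/-- The form is `σ`-invariant, so `σ^i b` pairs with the eigenvector `a` to a multiple of `(a|b)`,
and the root of unity in the projection undoes the factor. This matches `currentMode_lie`, where `b`
is arbitrary: the mode at `q = -p` sees only one eigencomponent of `b`, and that component carries
the whole pairing with `a`. -/
lemma form_eigenProjection (hN : 0 < N) {p q : ℤ} (hpq : p + q = 0) {a : 𝔤}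
    (ha : σ a = Complex.exp (-(2 * Real.pi * Complex.I * p / N)) • a) (b : 𝔤) :
    κ.form a (eigenProjection σ N q b) = κ.form a b := by
  have hq : (q : ℂ) = -p := by
    rw [← Int.cast_neg]; congr 1; omega
  have h : ∀ i : ℕ, Complex.exp (2 * Real.pi * Complex.I * q / N) ^ i *
      κ.form a (σ^[i] b) = κ.form a b := by
    intro i
    induction i with
    | zero => simp
    | succ i ih =>
      have e := κ.map_apply σ a (σ^[i] b)
      rw [ha, map_smul, LinearMap.smul_apply, smul_eq_mul, ← Function.iterate_succ_apply' (f := σ)]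
        at e
      rw [pow_succ, mul_assoc, ← ih, ← e, hq, mul_neg, neg_div]
  rw [eigenProjection, map_smul, map_sum]
  simp_rw [map_smul, smul_eq_mul, h]
  rw [Finset.sum_const, Finset.card_range, nsmul_eq_mul,
    inv_mul_cancel_left₀ (by exact_mod_cast hN.ne')]

/-- Some eigenspace of `σ` for `e^(-2πip/N)` with `p ≠ 0` is nonzero. -/
lemma exists_eigenvector (hN : 0 < N) (hσ : ∀ a, σ^[N] a = a) :
    ∃ (p : ℤ) (a : 𝔤), p ≠ 0 ∧ a ≠ 0 ∧
      σ a = Complex.exp (-(2 * Real.pi * Complex.I * p / N)) • a := by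
  have := nontrivial_of_isSimple 𝔤
  have hN0 : (N : ℂ) ≠ 0 := by exact_mod_cast hN.ne'
  obtain ⟨μ, hμ⟩ := Module.End.exists_eigenvalue (σ : 𝔤 →ₗ[ℂ] 𝔤)
  obtain ⟨a, ha, ha0⟩ := hμ.exists_hasEigenvector
  rw [Module.End.mem_eigenspace_iff] at ha
  change σ a = μ • a at ha
  have hpow : ∀ i : ℕ, σ^[i] a = μ ^ i • a := by
    intro i
    induction i with
    | zero => simp
    | succ i ih => rw [Function.iterate_succ_apply', ih, map_smul, ha, smul_smul, pow_succ]
  have h1 : μ ^ N = 1 := by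
    have h := hpow N
    rw [hσ] at h
    by_contra h'
    exact (smul_ne_zero (sub_ne_zero.2 h') ha0) (by rw [sub_smul, ← h, one_smul, sub_self])
  have := NeZero.mk hN.ne'
  -- The eigenvalue is an `N`-th root of unity, hence `e^(2πi/N)` to some power `i < N`.
  obtain ⟨i, hi, rfl⟩ := (Complex.isPrimitiveRoot_exp N hN.ne').eq_pow_of_pow_eq_one h1
  -- The natural exponent `-i` is zero when the eigenvalue is `1`; subtracting `N` leaves the
  -- eigenvalue unchanged and makes the exponent strictly negative.
  refine ⟨-i - N, a, by omega, ha0, ?_⟩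
  rw [ha, ← Complex.exp_nat_mul]
  congr 1
  rw [Complex.exp_eq_exp_iff_exists_int]
  -- The shift by `N` adds `2πi` to the argument of the exponential on the right, which the integer
  -- `-1` takes back.
  refine ⟨-1, ?_⟩
  push_cast
  field_simp
  ring

/-! ### The representation and its image -/

/-- The action of the twisted affine algebra on a twisted module over `V_k(𝔤)`. -/
def twistedRep : twistedAffine κ σ.symm N →ₗ⁅ℂ⁆ Module.End ℂ M :=
  -- The linear map is defined on all of `ĝ`, but `currentMode_lie` gives the bracket relation only
  -- when the first argument is an eigenvector. Compatibility with brackets is therefore checked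
  -- only on the twisted subalgebra, by span induction in both arguments.
  { levelLinear (κ := κ) (k / N) (currentMode Y) ∘ₗ
      (twistedAffine κ σ.symm N).toSubmodule.subtype with
    map_lie' := by
      rintro ⟨x, hx⟩ ⟨y, hy⟩
      change levelLinear (k / N) (currentMode Y) ⁅x, y⁆ =
        ⁅levelLinear (k / N) (currentMode Y) x, levelLinear (k / N) (currentMode Y) y⁆
      change x ∈ Submodule.span ℂ _ at hx
      change y ∈ Submodule.span ℂ _ at hy
      induction hx using Submodule.span_induction with
      | zero => rw [zero_lie, map_zero, zero_lie]
      | add u v _ _ hu hv => rw [add_lie, map_add, map_add, add_lie, hu, hv]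
      | smul c u _ hu => rw [smul_lie, map_smul, map_smul, smul_lie, hu]
      | mem x hx =>
        induction hy using Submodule.span_induction with
        | zero => rw [lie_zero, map_zero, lie_zero]
        | add u v _ _ hu hv => rw [lie_add, map_add, map_add, lie_add, hu, hv]
        | smul c u _ hu => rw [lie_smul, map_smul, map_smul, lie_smul, hu]
        | mem y hy =>
          rcases hx with ⟨i, a, ha, rfl⟩ | rfl
          · rcases hy with ⟨j, b, hb, rfl⟩ | rfl
            -- The central terms agree because `i (a|b) · (k/N) = (i/N) · (a|b) k`; this fixes the
            -- value `k/N` for `K`.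
            · rw [current_lie_current, map_add, map_smul, levelLinear_central, levelLinear_current,
                levelLinear_current, levelLinear_current,
                currentMode_lie Y (symm_eigen_iff.1 ha) j b, smul_smul, ite_mul, zero_mul]
              congr 3
              ring
            · rw [← lie_skew, central_lie, neg_zero, map_zero, levelLinear_central]
              simp [LieRing.of_associative_ring_bracket]
          · rw [central_lie, map_zero, levelLinear_central]
            simp [LieRing.of_associative_ring_bracket] }

lemma twistedRep_current (j : ℤ) (a : 𝔤)
    (ha : σ.symm a = Complex.exp (2 * Real.pi * Complex.I * j / N) • a) :
    twistedRep Y (twistedCurrent κ σ.symm N j a ha) = currentMode Y j a :=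
  levelLinear_current _ _ _ _

lemma twistedRep_central :
    twistedRep Y (twistedCentral κ σ.symm N) = (k / N) • (1 : Module.End ℂ M) :=
  levelLinear_central _ _

/-- The Lie algebra generated by the modes of the currents contains the image of `K`. -/
lemma level_mem_lieSpan (hN : 0 < N) (hσ : ∀ a, σ^[N] a = a) :
    (k / N) • (1 : Module.End ℂ M) ∈ LieSubalgebra.lieSpan ℂ (Module.End ℂ M)
      {f | ∃ (a : 𝔤) (p : ℤ), f = Y.mode (currentVector κ k a) p} := by
  obtain ⟨p, a, hp, ha0, ha⟩ := exists_eigenvector (σ := σ) hN hσ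
  obtain ⟨b, hb⟩ : ∃ b, κ.form a b ≠ 0 := by
    by_contra! h
    exact ha0 (κ.nondegenerate.1 a h)
  have hmem : ∀ (q : ℤ) (x : 𝔤), currentMode Y q x ∈ LieSubalgebra.lieSpan ℂ (Module.End ℂ M)
      {f | ∃ (a : 𝔤) (p : ℤ), f = Y.mode (currentVector κ k a) p} :=
    fun q x => LieSubalgebra.subset_lieSpan ⟨x, q, rfl⟩
  -- At opposite indices the central term survives: after subtraction of the mode of `[a, b]` at
  -- `0`, what remains is `(p/N) (a|b) k`.
  have h := currentMode_lie Y ha (-p) b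
  rw [add_neg_cancel, if_pos rfl, ← sub_eq_iff_eq_add'] at h
  have h' := sub_mem (LieSubalgebra.lie_mem _ (hmem p a) (hmem (-p) b)) (hmem 0 ⁅a, b⁆)
  rw [h] at h'
  have hp' : (p : ℂ) ≠ 0 := by exact_mod_cast hp
  -- Both `p` and `(a|b)` are nonzero by choice, so dividing by them leaves `k/N`. The level `k`
  -- itself is not inverted and may be zero.
  have := SMulMemClass.smul_mem ((p : ℂ) * κ.form a b)⁻¹ h'
  rw [smul_smul] at this
  convert this using 2
  field_simp

/-- Twisted currents act by modes, and `K` by a scalar already in the span by `level_mem_lieSpan`.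
Conversely, the range is a Lie subalgebra, so it is enough that it contains the generating modes. -/
lemma twistedRep_range (hN : 0 < N) (hσ : ∀ a, σ^[N] a = a) :
    (twistedRep Y).range = LieSubalgebra.lieSpan ℂ (Module.End ℂ M)
      {f | ∃ (a : 𝔤) (p : ℤ), f = Y.mode (currentVector κ k a) p} := by
  apply le_antisymm
  · rintro _ ⟨x, rfl⟩
    induction x using twistedAffine_induction with
    | h0 =>
      change twistedRep Y 0 ∈ _
      rw [map_zero]
      exact zero_mem _
    | hadd x y hx hy =>
      change twistedRep Y (x + y) ∈ _
      rw [map_add]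
      exact add_mem hx hy
    | hsmul c x hx =>
      change twistedRep Y (c • x) ∈ _
      rw [map_smul]
      exact SMulMemClass.smul_mem c hx
    | hcur j a ha => exact LieSubalgebra.subset_lieSpan ⟨a, j, twistedRep_current Y j a ha⟩
    | hcen =>
      have := level_mem_lieSpan Y hN hσ
      rwa [← twistedRep_central Y] at this
  · rw [LieSubalgebra.lieSpan_le]
    rintro _ ⟨a, p, rfl⟩
    -- For arbitrary `a` the element `a ⊗ t^p` need not be in the twisted algebra; its
    -- eigencomponent for the index `p` is, and it has the same mode.
    refine ⟨twistedCurrent κ σ.symm N p (eigenProjection σ N p a)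
      (symm_eigen_iff.2 (map_eigenProjection hN hσ p a)), ?_⟩
    exact (twistedRep_current Y p _ _).trans (currentMode_eigenProjection Y hN p a)

end TwistedCurrents

end AffineVertex

end

/-! ### The main theorem -/

theorem mainTheorem2 {𝔤 : Type*} [LieRing 𝔤] [LieAlgebra ℂ 𝔤] [FiniteDimensional ℂ 𝔤]
    [LieAlgebra.IsSimple ℂ 𝔤] (κ : InvariantForm 𝔤) (k : ℂ) (σ : 𝔤 ≃ₗ⁅ℂ⁆ 𝔤)
    (N : ℕ) (hN : 0 < N) (hσ : ∀ a, σ^[N] a = a)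
    {M : Type*} [AddCommGroup M] [Module ℂ M]
    (Y : TwistedModule (universalAffine κ k) (affineAut κ k σ) N M) :
    ∃! ρ : twistedAffine κ σ.symm N →ₗ⁅ℂ⁆ Module.End ℂ M,
      (∀ (j : ℤ) (a : 𝔤) (ha : σ.symm a = Complex.exp (2 * Real.pi * Complex.I * j / N) • a),
        ρ (twistedCurrent κ σ.symm N j a ha) = Y.mode (currentVector κ k a) j) ∧
      ρ (twistedCentral κ σ.symm N) = (k / N) • (1 : Module.End ℂ M) ∧
      ρ.range = LieSubalgebra.lieSpan ℂ (Module.End ℂ M)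
        {f | ∃ (a : 𝔤) (p : ℤ), f = Y.mode (currentVector κ k a) p} := by
  refine ⟨twistedRep Y, ⟨twistedRep_current Y, twistedRep_central Y, twistedRep_range Y hN hσ⟩, ?_⟩
  -- The condition on the range is discarded: the values on the `a ⊗ t^j` and on `K` already
  -- determine `ρ`, so uniqueness holds under the first two conditions alone.
  rintro ρ ⟨hcur, hcen, -⟩
  ext1 x
  induction x using twistedAffine_induction with
  | h0 => rw [map_zero, map_zero]
  | hadd x y hx hy => rw [map_add, map_add, hx, hy]
  | hsmul c x hx => rw [map_smul, map_smul, hx]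
  | hcur j a ha => rw [hcur, twistedRep_current, currentMode_apply]
  | hcen => rw [hcen, twistedRep_central]
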